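/- Let $f=(f_{ij})_{i,j\in\{1,2\}}$ be a symmetric $2$-tensor field on $\mathbb{R}^2$ whose (real or complex valued) components belong to the Schwartz space $\mathcal{S}(\mathbb{R}^2)$. For a smooth scalar field $v$ write $(\mathrm{d}v)_i=\partial_i v$ and $(\mathrm{d}^2v)_{ij}=\partial_i\partial_j v$, and for a smooth symmetric $2$-tensor field $g$ write $\delta^2 g=\sum_{i,j}\partial_i\partial_j g_{ij}$. (1) Suppose that $\int_{\mathbb{R}^2} f_{ij}(x)\,dx=0$ for all $i,j$. Then there are a smooth symmetric $2$-tensor field $g$ and a smooth scalar field $v$ on $\mathbb{R}^2$ with $$f=g+\mathrm{d}^2v,\qquad \delta^2g=0,\qquad g(x)\to0\ \text{ and }\ v(x)\to 0\ \text{ as } |x|\to\infty, \tag{$*$}$$ and the pair $(g,v)$ is unique among all pairs of a smooth symmetric $2$-tensor field and a smooth scalar field satisfying $(*)$. Moreover there is a constant $C$ (depending on $f$) such that for all $x\in\mathbb{R}^2$ $$|g(x)|\le C(1+|x|)^{-2},\qquad |\mathrm{d}^{\ell}v(x)|\le C(1+|x|)^{-\ell}\quad(\ell=0,1).$$ (2)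 Conversely, if there exist a smooth symmetric $2$-tensor field $g$ and a smooth scalar field $v$ satisfying $(*)$, then $\int_{\mathbb{R}^2} f_{ij}(x)\,dx=0$ for all $i,j$. -/

import Mathlib

open scoped ContDiff Topology
open Filter MeasureTheory

namespace TensorDecomp

/-- The Euclidean space `ℝⁿ`. -/
abbrev Rn (n : ℕ) : Type := EuclideanSpace ℝ (Fin n)

/-- Rank `m` tensor fields on `ℝⁿ`, given by their components in Cartesian coordinates:
`u x I` is the component `u_{i₁ … i_m}(x)`, where `I = (i₁, …, i_m)`. -/
abbrev TensorField (𝕜 : Type*) (n m : ℕ) : Type _ := Rn n → (Fin m → Fin n) → 𝕜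

section
variable {𝕜 : Type*} [RCLike 𝕜] {n m : ℕ}

/-- The tensor field is symmetric in all its indices at every point. -/
def IsSymmetric (u : TensorField 𝕜 n m) : Prop :=
  ∀ (x : Rn n) (π : Equiv.Perm (Fin m)) (I : Fin m → Fin n), u x (I ∘ π) = u x I

/-- The Euclidean norm `|T| = (∑ |T_{i₁ … i_m}|²)^{1/2}` of a tensor. -/
noncomputable def tensorNorm (T : (Fin m → Fin n) → 𝕜) : ℝ :=
  Real.sqrt (∑ I, ‖T I‖ ^ 2)

/-- The partial derivative `∂h/∂x_i`. -/
noncomputable def partialDeriv (i : Fin n) (h : Rn n → 𝕜) (x : Rn n) : 𝕜 :=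
  fderiv ℝ h x (EuclideanSpace.single i 1)

/-- The symmetrization of a tensor. -/
noncomputable def symmetrize (T : (Fin m → Fin n) → 𝕜) : (Fin m → Fin n) → 𝕜 :=
  fun I => ((m.factorial : 𝕜))⁻¹ * ∑ π : Equiv.Perm (Fin m), T (I ∘ π)

/-- The inner differentiation (symmetrized derivative)
`(d u)_{i₁ … i_{m+1}} = σ(i₁, …, i_{m+1}) (∂u_{i₁ … i_m} / ∂x_{i_{m+1}})`. -/
noncomputable def innerD (u : TensorField 𝕜 n m) : TensorField 𝕜 n (m + 1) :=
  fun x => symmetrize fun I => partialDeriv (I (Fin.last m)) (fun y => u y (Fin.init I)) x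

/-- The iterates `d^ℓ v` of the inner differentiation on a scalar field `v`. -/
noncomputable def innerDPow : (ℓ : ℕ) → (Rn n → 𝕜) → TensorField 𝕜 n ℓ
  | 0, v => fun x _ => v x
  | ℓ + 1, v => innerD (innerDPow ℓ v)

/-- The divergence `(δ u)_{i₁ … i_m} = ∑_j ∂u_{i₁ … i_m j} / ∂x_j`. -/
noncomputable def divergence (u : TensorField 𝕜 n (m + 1)) : TensorField 𝕜 n m :=
  fun x I => ∑ j, partialDeriv j (fun y => u y (Fin.snoc (α := fun _ => Fin n) I j)) x

/-- The tensor field whose components are the given Schwartz functions. -/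
noncomputable def ofSchwartz (f : (Fin m → Fin n) → SchwartzMap (Rn n) 𝕜) : TensorField 𝕜 n m :=
  fun x I => f I x

/-- `f = g + d²v` with `δ²g = 0`, where `g` is a smooth symmetric `2`-tensor field, `v` is a smooth
scalar field, and both tend to `0` at infinity. -/
structure IsDecayingDecomposition (f g : TensorField 𝕜 n 2) (v : Rn n → 𝕜) : Prop where
  smooth_g : ContDiff ℝ ∞ g
  symm_g : IsSymmetric g
  smooth_v : ContDiff ℝ ∞ v
  decomp : f = g + innerDPow 2 v
  solenoidal : divergence (divergence g) = 0
  tendsto_g : Tendsto g (cocompact (Rn n)) (𝓝 0)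
  tendsto_v : Tendsto v (cocompact (Rn n)) (𝓝 0)

end

end TensorDecomp

/-!
Taking the double divergence of `f = g + d²v` gives `Δ²v = δ²f`, a biharmonic equation for the
potential `v`, and conversely a solution `v` of this equation determines `g = f - d²v`. Everything
is therefore about the squared Laplacian on the plane.

*Uniqueness.* The difference `u` of two potentials is biharmonic and tends to zero together with its
Hessian. Hence `Δu` is harmonic and tends to zero, so `Δu = 0` by Liouville's theorem, and then
`u = 0` for the same reason (`eq_zero_of_biharmonic_of_tendsto`).

*Existence.* The kernel `E(x) = |x|² log |x|²` is a multiple of a fundamental solution of `Δ²`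
(`conv_biharmonicKernel_zero`). This follows by regularization: with `s = a + |x|²`, the function
`s log s` is smooth, and `Δ²(s log s) = 32 a² / s³` is an approximate identity as `a → 0`. Up to a
constant, the solution is `v = E * δ²f`. For its decay, a cutoff splits `E` into a continuous kernel
of compact support, whose convolution with any Schwartz function decays rapidly, and a smooth kernel
onto which all derivatives can be moved. The second derivatives of `E` are homogeneous of degree
zero up to an additive logarithm of the dilation factor, so its third and fourth derivatives are
homogeneous of degrees `-1` and `-2` and decay at these rates. This bounds `dv` by
`(1 + |x|)⁻¹` and `d²v`, hence `g`, by `(1 + |x|)⁻²` (`decayBdd_conv_three`, `decayBdd_conv_four`).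
For `v` itself only two derivatives fall on the kernel, and the vanishing integrals of `f`, through
the mean value inequality, supply one more order of decay (`decayBdd_conv_two`).

*Necessity.* Let `χ` be smooth with compact support. Testing the decomposition against the Hessian
of `χ(t x)` removes `g`, and letting `t → 0` shows that the Hessian of `χ` at the origin is
orthogonal to the matrix of integrals of `f`, since `v` vanishes at infinity
(`IsDecayingDecomposition.sum_hessian_smul_integral`). Choosing `χ = xₐ x_b` near the origin, each
integral is zero.
-/

namespace TensorDecomp

/-! ### Partial derivatives -/

section Basic
variable {𝕜 : Type*} [RCLike 𝕜] {n : ℕ}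

theorem contDiff_partialDeriv {h : Rn n → 𝕜} (hh : ContDiff ℝ ∞ h) (i : Fin n) :
    ContDiff ℝ ∞ (partialDeriv i h) :=
  (hh.fderiv_right (m := ∞) (by simp)).clm_apply contDiff_const

theorem partialDeriv_comm {h : Rn n → 𝕜} (hh : ContDiff ℝ ∞ h) (i j : Fin n) :
    partialDeriv i (partialDeriv j h) = partialDeriv j (partialDeriv i h) := by
  have key : ∀ a b : Fin n, ∀ x, partialDeriv a (partialDeriv b h) x =
      fderiv ℝ (fderiv ℝ h) x (EuclideanSpace.single a 1) (EuclideanSpace.single b 1) := by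
    intro a b x
    have hd : DifferentiableAt ℝ (fderiv ℝ h) x :=
      ((hh.fderiv_right (m := ∞) (by simp)).differentiable (by simp)) x
    unfold partialDeriv
    rw [fderiv_clm_apply hd (differentiableAt_const _)]
    simp
  ext x
  rw [key, key]
  refine (hh.contDiffAt.isSymmSndFDerivAt ?_).eq _ _
  rw [minSmoothness_of_isRCLikeNormedField]
  exact ENat.LEInfty.out

theorem partialDeriv_add {g h : Rn n → 𝕜} (hg : ContDiff ℝ ∞ g) (hh : ContDiff ℝ ∞ h)
    (i : Fin n) :
    partialDeriv i (fun x => g x + h x) = fun x => partialDeriv i g x + partialDeriv i h x := by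
  ext x
  unfold partialDeriv
  rw [fderiv_fun_add (hg.differentiable (by simp) x) (hh.differentiable (by simp) x)]
  rfl

theorem partialDeriv_sub {g h : Rn n → 𝕜} (hg : ContDiff ℝ ∞ g) (hh : ContDiff ℝ ∞ h)
    (i : Fin n) :
    partialDeriv i (fun x => g x - h x) = fun x => partialDeriv i g x - partialDeriv i h x := by
  ext x
  unfold partialDeriv
  rw [fderiv_fun_sub (hg.differentiable (by simp) x) (hh.differentiable (by simp) x)]
  rfl

theorem partialDeriv_sum {ι : Type*} (s : Finset ι) {g : ι → Rn n → 𝕜}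
    (hg : ∀ k, ContDiff ℝ ∞ (g k)) (i : Fin n) :
    partialDeriv i (fun x => ∑ k ∈ s, g k x) = fun x => ∑ k ∈ s, partialDeriv i (g k) x := by
  ext x
  unfold partialDeriv
  rw [fderiv_fun_sum fun k _ => (hg k).differentiable (by simp) x]
  simp

theorem norm_fderiv_le_sum_partialDeriv (h : Rn n → 𝕜) (x : Rn n) :
    ‖fderiv ℝ h x‖ ≤ ∑ i, ‖partialDeriv i h x‖ := by
  refine ContinuousLinearMap.opNorm_le_bound _ (by positivity) fun y => ?_
  have hy : y = ∑ i, y i • EuclideanSpace.single i (1 : ℝ) := by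
    ext j
    simp [Finset.sum_apply, Pi.single_apply]
  conv_lhs => rw [hy]
  rw [map_sum, Finset.sum_mul]
  refine (norm_sum_le _ _).trans (Finset.sum_le_sum fun i _ => ?_)
  rw [map_smul, norm_smul, mul_comm]
  exact mul_le_mul_of_nonneg_left (PiLp.norm_apply_le y i) (norm_nonneg _)

end Basic

/-! ### Convolution of a polynomially bounded kernel with a Schwartz function -/

section Conv
variable {n : ℕ} {F : Type*} [NormedAddCommGroup F] [NormedSpace ℝ F]

/-- The function is bounded by `C (1 + |x|)ᵏ` for some `C` and `k`. -/
def PolyBdd {G : Type*} [NormedAddCommGroup G] (K : Rn n → G) : Prop :=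
  ∃ (C : ℝ) (k : ℕ), ∀ x, ‖K x‖ ≤ C * (1 + ‖x‖) ^ k

/-- The convolution `∫ K(y) φ(x - y) dy` of a real kernel with a vector-valued function. It is used
only where the integrand is integrable. -/
noncomputable def conv (K : Rn n → ℝ) (φ : Rn n → F) (x : Rn n) : F :=
  ∫ y, K y • φ (x - y)

/-- **Peetre's inequality.** -/
theorem one_add_norm_pow_le (x y : Rn n) (k : ℕ) :
    (1 + ‖x‖) ^ k ≤ (1 + ‖y‖) ^ k * (1 + ‖x - y‖) ^ k := by
  rw [← mul_pow]
  refine pow_le_pow_left₀ (by positivity) ?_ k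
  have := norm_le_norm_add_norm_sub' x y
  nlinarith [norm_nonneg y, norm_nonneg (x - y)]

theorem schwartz_weighted_bound (φ : SchwartzMap (Rn n) F) (k : ℕ) :
    ∃ C, 0 ≤ C ∧ ∀ x, (1 + ‖x‖) ^ k * ‖φ x‖ ≤ C := by
  refine ⟨_, ?_, fun x => by
    simpa using SchwartzMap.one_add_le_sup_seminorm_apply (𝕜 := ℝ) (m := (k, 0)) (k := k) (n := 0)
      le_rfl le_rfl φ x⟩
  positivity

theorem integrable_one_add_norm_rpow_neg :
    Integrable (fun y : Rn n => (1 + ‖y‖) ^ (-(n + 1 : ℝ))) :=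
  integrable_one_add_norm (by simp)

/-- A majorant for the integrand of a convolution that is integrable in `y` and locally uniform in
`x`. -/
theorem norm_smul_comp_sub_le {K : Rn n → ℝ} (hK : PolyBdd K) (φ : SchwartzMap (Rn n) F) :
    ∃ (C : ℝ) (k : ℕ), 0 ≤ C ∧ ∀ x y,
      ‖K y • φ (x - y)‖ ≤ C * (1 + ‖x‖) ^ k * (1 + ‖y‖) ^ (-(n + 1 : ℝ)) := by
  obtain ⟨C, k, hC⟩ := hK
  obtain ⟨D, hD0, hD⟩ := schwartz_weighted_bound φ (k + (n + 1))
  have hC0 : 0 ≤ C := by simpa using (norm_nonneg _).trans (hC 0)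
  refine ⟨C * D, k + (n + 1), by positivity, fun x y => ?_⟩
  have hp : (1 + ‖y‖) ^ (-(n + 1 : ℝ)) = ((1 + ‖y‖) ^ (n + 1))⁻¹ := by
    rw [Real.rpow_neg (by positivity)]
    norm_cast
  rw [hp, ← div_eq_mul_inv, le_div_iff₀ (by positivity), norm_smul]
  calc ‖K y‖ * ‖φ (x - y)‖ * (1 + ‖y‖) ^ (n + 1)
      ≤ (C * (1 + ‖y‖) ^ k) * ‖φ (x - y)‖ * (1 + ‖y‖) ^ (n + 1) := by gcongr; exact hC y
    _ = C * ((1 + ‖y‖) ^ (k + (n + 1)) * ‖φ (x - y)‖) := by ring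
    _ ≤ C * (((1 + ‖x‖) ^ (k + (n + 1)) * (1 + ‖x - y‖) ^ (k + (n + 1))) * ‖φ (x - y)‖) := by
        gcongr
        rw [← norm_sub_rev y x]
        exact one_add_norm_pow_le y x _
    _ = C * (1 + ‖x‖) ^ (k + (n + 1)) * ((1 + ‖x - y‖) ^ (k + (n + 1)) * ‖φ (x - y)‖) := by ring
    _ ≤ C * (1 + ‖x‖) ^ (k + (n + 1)) * D := by gcongr; exact hD _
    _ = _ := by ring

theorem integrable_conv_integrand {K : Rn n → ℝ} (hK : PolyBdd K)
    (hm : AEStronglyMeasurable K) (φ : SchwartzMap (Rn n) F) (x : Rn n) :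
    Integrable (fun y => K y • φ (x - y)) := by
  obtain ⟨C, k, -, h⟩ := norm_smul_comp_sub_le hK φ
  exact (integrable_one_add_norm_rpow_neg.const_mul (C * (1 + ‖x‖) ^ k)).mono'
    (hm.smul (φ.continuous.comp (continuous_const.sub continuous_id)).aestronglyMeasurable)
    (Eventually.of_forall fun y => h x y)

/-- A convolution is differentiated by differentiating the Schwartz function. -/
theorem hasFDerivAt_conv {K : Rn n → ℝ} (hK : PolyBdd K)
    (hm : AEStronglyMeasurable K) (φ : SchwartzMap (Rn n) F) (x : Rn n) :
    HasFDerivAt (conv K φ) (conv K (SchwartzMap.fderivCLM ℝ (Rn n) F φ) x) x := by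
  obtain ⟨C, k, hC0, h⟩ := norm_smul_comp_sub_le hK (SchwartzMap.fderivCLM ℝ (Rn n) F φ)
  refine hasFDerivAt_integral_of_dominated_of_fderiv_le (s := Metric.ball x 1)
    (bound := fun y => (C * (1 + (‖x‖ + 1)) ^ k) * (1 + ‖y‖) ^ (-(n + 1 : ℝ)))
    (F' := fun z y => K y • SchwartzMap.fderivCLM ℝ (Rn n) F φ (z - y))
    (Metric.ball_mem_nhds x one_pos) (Eventually.of_forall fun z =>
      (integrable_conv_integrand hK hm φ z).aestronglyMeasurable)
    (integrable_conv_integrand hK hm φ x)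
    (integrable_conv_integrand hK hm _ x).aestronglyMeasurable
    (Eventually.of_forall fun y z hz => (h z y).trans ?_)
    (integrable_one_add_norm_rpow_neg.const_mul _) (Eventually.of_forall fun y z _ => ?_)
  · have : ‖z‖ ≤ ‖x‖ + 1 := by
      have h1 := norm_le_norm_add_norm_sub' z x
      rw [Metric.mem_ball, dist_eq_norm] at hz
      linarith
    gcongr
  · have h1 : HasFDerivAt (fun z => φ (z - y)) (fderiv ℝ φ (z - y)) z := by
      simpa [Function.comp_def] using
        HasFDerivAt.comp z (φ.hasFDerivAt (z - y)) ((hasFDerivAt_id z).sub_const y)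
    exact h1.const_smul (K y)

/-- The induction on the order of differentiability runs over all target spaces at once, since the
derivative is a convolution with values in the continuous linear maps. -/
theorem contDiff_conv {K : Rn n → ℝ} (hK : PolyBdd K)
    (hm : AEStronglyMeasurable K) (φ : SchwartzMap (Rn n) F) : ContDiff ℝ ∞ (conv K φ) := by
  have key : ∀ (m : ℕ) {F : Type _} [NormedAddCommGroup F] [NormedSpace ℝ F]
      (φ : SchwartzMap (Rn n) F), ContDiff ℝ m (conv K φ) := by
    intro m
    induction m with
    | zero =>
      intro F _ _ φ
      have : Differentiable ℝ (conv K φ) :=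
        fun x => (hasFDerivAt_conv hK hm φ x).differentiableAt
      exact contDiff_zero.2 this.continuous
    | succ m ih =>
      intro F _ _ φ
      refine contDiff_succ_iff_hasFDerivAt.2 ⟨_, ih _, fun x => hasFDerivAt_conv hK hm φ x⟩
  exact contDiff_infty.2 fun m => key m φ

end Conv

/-! ### Moving derivatives across a convolution -/

section ConvScalar
variable {n : ℕ} {𝕜 : Type*} [RCLike 𝕜]

/-- The partial derivative of a Schwartz function, as a Schwartz function. -/
noncomputable def schwartzPartial (i : Fin n) (φ : SchwartzMap (Rn n) 𝕜) : SchwartzMap (Rn n) 𝕜 :=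
  LineDeriv.lineDerivOp (EuclideanSpace.single i (1 : ℝ)) φ

theorem coe_schwartzPartial (i : Fin n) (φ : SchwartzMap (Rn n) 𝕜) :
    ⇑(schwartzPartial i φ) = partialDeriv i φ := rfl

theorem schwartzPartial_sum {ι : Type*} (s : Finset ι) (i : Fin n)
    (φ : ι → SchwartzMap (Rn n) 𝕜) :
    schwartzPartial i (∑ k ∈ s, φ k) = ∑ k ∈ s, schwartzPartial i (φ k) :=
  LineDeriv.lineDerivOp_sum _ _ _

theorem schwartzPartial_comm (i j : Fin n) (φ : SchwartzMap (Rn n) 𝕜) :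
    schwartzPartial i (schwartzPartial j φ) = schwartzPartial j (schwartzPartial i φ) := by
  ext x
  simp only [coe_schwartzPartial]
  rw [partialDeriv_comm (φ.smooth _)]

theorem partialDeriv_conv {K : Rn n → ℝ} (hK : PolyBdd K)
    (hm : AEStronglyMeasurable K) (φ : SchwartzMap (Rn n) 𝕜) (i : Fin n) :
    partialDeriv i (conv K φ) = conv K (schwartzPartial i φ) := by
  ext x
  unfold partialDeriv
  rw [(hasFDerivAt_conv hK hm φ x).fderiv]
  unfold conv
  rw [ContinuousLinearMap.integral_apply (integrable_conv_integrand hK hm _ x)]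
  rfl

theorem conv_sum {ι : Type*} (s : Finset ι) {K : Rn n → ℝ} (hK : PolyBdd K)
    (hm : AEStronglyMeasurable K) (φ : ι → SchwartzMap (Rn n) 𝕜) (x : Rn n) :
    conv K (∑ k ∈ s, φ k : SchwartzMap (Rn n) 𝕜) x = ∑ k ∈ s, conv K (φ k) x := by
  unfold conv
  rw [← integral_finsetSum _ fun k _ => integrable_conv_integrand hK hm (φ k) x]
  congr 1 with y
  rw [sum_apply, Finset.smul_sum]

theorem conv_add_left {K L : Rn n → ℝ} (hK : PolyBdd K) (hm : AEStronglyMeasurable K)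
    (hL : PolyBdd L) (hl : AEStronglyMeasurable L) (φ : SchwartzMap (Rn n) 𝕜) (x : Rn n) :
    conv (fun y => K y + L y) φ x = conv K φ x + conv L φ x := by
  unfold conv
  rw [← integral_add (integrable_conv_integrand hK hm φ x) (integrable_conv_integrand hL hl φ x)]
  simp only [add_smul]

/-- Integration by parts moves a derivative from the Schwartz function to the kernel. -/
theorem conv_schwartzPartial {K : Rn n → ℝ} (hK : PolyBdd K) (hd : Differentiable ℝ K)
    {i : Fin n} (hK' : PolyBdd (partialDeriv i K)) (hm' : AEStronglyMeasurable (partialDeriv i K))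
    (φ : SchwartzMap (Rn n) 𝕜) :
    conv K (schwartzPartial i φ) = conv (partialDeriv i K) φ := by
  ext x
  have hm : AEStronglyMeasurable K := hd.continuous.aestronglyMeasurable
  have hφ : ∀ y, HasFDerivAt (fun y => φ (x - y)) (-fderiv ℝ φ (x - y)) y := fun y => by
    simpa [Function.comp_def] using
      HasFDerivAt.comp y (φ.hasFDerivAt (x - y)) ((hasFDerivAt_id y).const_sub x)
  have key := integral_bilinear_hasFDerivAt_right_eq_neg_left_of_integrable (μ := volume)
    (f := K) (f' := fderiv ℝ K) (g := fun y => φ (x - y)) (g' := fun y => -fderiv ℝ φ (x - y))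
    (v := EuclideanSpace.single i (1 : ℝ)) (B := ContinuousLinearMap.lsmul ℝ ℝ)
    (integrable_conv_integrand hK' hm' φ x)
    (by simpa [schwartzPartial, SchwartzMap.lineDerivOp_apply_eq_fderiv] using
      (integrable_conv_integrand hK hm (schwartzPartial i φ) x).neg)
    (integrable_conv_integrand hK hm φ x) (fun y _ => (hd y).hasFDerivAt) (fun y _ => hφ y)
  simp only [ContinuousLinearMap.lsmul_apply, neg_apply, smul_neg,
    integral_neg, neg_inj] at key
  exact key

end ConvScalar
/-! ### The tensor operations in components -/

section Components
variable {𝕜 : Type*} [RCLike 𝕜] {n : ℕ}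

theorem innerDPow_one_apply (v : Rn n → 𝕜) (x : Rn n) (I : Fin 1 → Fin n) :
    innerDPow 1 v x I = partialDeriv (I 0) v x := by
  simp [innerDPow, innerD, symmetrize]

theorem innerDPow_two_apply {v : Rn n → 𝕜} (hv : ContDiff ℝ ∞ v) (x : Rn n)
    (I : Fin 2 → Fin n) :
    innerDPow 2 v x I = partialDeriv (I 0) (partialDeriv (I 1) v) x := by
  have h1 : innerDPow 2 v x I = symmetrize (fun I : Fin 2 → Fin n =>
      partialDeriv (I 1) (fun y => innerDPow 1 v y (Fin.init I)) x) I := rfl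
  rw [h1]
  simp only [innerDPow_one_apply, symmetrize]
  have hu : (Finset.univ : Finset (Equiv.Perm (Fin 2))) = {1, Equiv.swap 0 1} := by decide
  have hc : partialDeriv (I 0) (partialDeriv (I 1) v) x =
      partialDeriv (I 1) (partialDeriv (I 0) v) x := by rw [partialDeriv_comm hv]
  rw [hu, Finset.sum_pair (by decide)]
  simp only [Function.comp_apply, Fin.init, Equiv.Perm.coe_one, id_eq, Equiv.swap_apply_right,
    Fin.castSucc_zero, Equiv.swap_apply_left]
  change ((2 : ℕ).factorial : 𝕜)⁻¹ * (partialDeriv (I 1) (partialDeriv (I 0) v) x +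
    partialDeriv (I 0) (partialDeriv (I 1) v) x) = _
  rw [← hc]
  simp [Nat.factorial]
  ring

theorem divergence_divergence_apply (g : TensorField 𝕜 n 2) (x : Rn n) (I : Fin 0 → Fin n) :
    divergence (divergence g) x I =
      ∑ j, partialDeriv j (fun y => ∑ k, partialDeriv k (fun z => g z ![j, k]) y) x := by
  have : ∀ j k : Fin n, (Fin.snoc (α := fun _ => Fin n)
      (Fin.snoc (α := fun _ => Fin n) I j) k : Fin 2 → Fin n) = ![j, k] := by
    intro j k
    ext i
    fin_cases i <;> simp [Fin.snoc]
  simp only [divergence]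
  refine Finset.sum_congr rfl fun j _ => ?_
  simp only [this]

end Components

/-! ### Liouville's theorem -/

section Liouville
variable {𝕜 : Type*} [RCLike 𝕜]

/-- **Liouville's theorem**: a harmonic function on the plane vanishing at infinity is zero. -/
theorem eq_zero_of_harmonic_of_tendsto {h : Rn 2 → 𝕜} (hh : ContDiff ℝ ∞ h)
    (hΔ : ∀ x, ∑ j, partialDeriv j (partialDeriv j h) x = 0)
    (h0 : Tendsto h (cocompact (Rn 2)) (𝓝 0)) : h = 0 := by
  set L : ℂ ≃ₗᵢ[ℝ] Rn 2 := Complex.orthonormalBasisOneI.repr with hL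
  have hL1 : L 1 = EuclideanSpace.single 0 1 := by
    simpa using Complex.orthonormalBasisOneI.repr_self 0
  have hLI : L Complex.I = EuclideanSpace.single 1 1 := by
    simpa using Complex.orthonormalBasisOneI.repr_self 1
  have hsnd : ∀ (x : Rn 2) (j : Fin 2), iteratedFDeriv ℝ 2 h x
      ![EuclideanSpace.single j 1, EuclideanSpace.single j 1] =
        partialDeriv j (partialDeriv j h) x := by
    intro x j
    have hd : DifferentiableAt ℝ (fderiv ℝ h) x :=
      ((hh.fderiv_right (m := ∞) (by simp)).differentiable (by simp)) x
    rw [iteratedFDeriv_two_apply]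
    unfold partialDeriv
    rw [fderiv_clm_apply hd (differentiableAt_const _)]
    simp
  have hit : ∀ (z w : ℂ), iteratedFDeriv ℝ 2 (h ∘ L) z ![w, w] =
      iteratedFDeriv ℝ 2 h (L z) ![L w, L w] := by
    intro z w
    have := ContinuousLinearMap.iteratedFDeriv_comp_right (𝕜 := ℝ) (i := 2)
      (L.toContinuousLinearEquiv : ℂ →L[ℝ] Rn 2) hh z ENat.LEInfty.out
    have h2 : (h ∘ L) = h ∘ (L.toContinuousLinearEquiv : ℂ →L[ℝ] Rn 2) := rfl
    rw [h2, this]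
    rw [ContinuousMultilinearMap.compContinuousLinearMap_apply]
    congr 1
    ext i
    fin_cases i <;> rfl
  have hharm : InnerProductSpace.HarmonicOnNhd (h ∘ L) Set.univ := by
    intro z _
    refine ⟨((hh.comp L.contDiff).of_le ENat.LEInfty.out).contDiffAt, ?_⟩
    refine Eventually.of_forall fun w => ?_
    rw [InnerProductSpace.laplacian_eq_iteratedFDeriv_complexPlane]
    simp only [hit, hL1, hLI, hsnd]
    have := hΔ (L w)
    rw [Fin.sum_univ_two] at this
    simpa using this
  have hb : Bornology.IsBounded (Set.range (h ∘ L)) := by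
    have := ZeroAtInftyContinuousMap.isBounded_range (⟨⟨h, hh.continuous⟩, h0⟩ :
      ZeroAtInftyContinuousMap (Rn 2) 𝕜)
    exact this.subset (Set.range_comp_subset_range L h)
  have hc := InnerProductSpace.bounded_harmonic_on_complex_plane_is_constant _ hharm hb
  have hconst : ∀ x, h x = h 0 := fun x => by
    simpa using hc (L.symm x) (L.symm 0)
  have h1 : Tendsto h (cocompact (Rn 2)) (𝓝 (h 0)) := by
    rw [show h = fun _ => h 0 from funext hconst]
    exact tendsto_const_nhds
  have h2 := tendsto_nhds_unique h0 h1
  ext x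
  rw [hconst x, ← h2]
  rfl

end Liouville
/-! ### Uniqueness -/

section Uniqueness
variable {𝕜 : Type*} [RCLike 𝕜] {n : ℕ}

theorem IsDecayingDecomposition.eq_add {F g : TensorField 𝕜 n 2} {v : Rn n → 𝕜}
    (h : IsDecayingDecomposition F g v) (x : Rn n) (I : Fin 2 → Fin n) :
    F x I = g x I + partialDeriv (I 0) (partialDeriv (I 1) v) x := by
  rw [← innerDPow_two_apply h.smooth_v, h.decomp]
  rfl

theorem IsDecayingDecomposition.contDiff_component {F g : TensorField 𝕜 n 2} {v : Rn n → 𝕜}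
    (h : IsDecayingDecomposition F g v) (I : Fin 2 → Fin n) : ContDiff ℝ ∞ (fun x => g x I) :=
  contDiff_pi.1 h.smooth_g I

theorem IsDecayingDecomposition.sum_partialDeriv_eq_zero {F g : TensorField 𝕜 n 2} {v : Rn n → 𝕜}
    (h : IsDecayingDecomposition F g v) (x : Rn n) :
    ∑ j, ∑ k, partialDeriv j (partialDeriv k (fun z => g z ![j, k])) x = 0 := by
  have h1 : divergence (divergence g) x Fin.elim0 = 0 := by rw [h.solenoidal]; rfl
  rw [divergence_divergence_apply] at h1
  rw [← h1]
  refine Finset.sum_congr rfl fun j _ => ?_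
  rw [partialDeriv_sum _ fun k => contDiff_partialDeriv (h.contDiff_component _) k]

/-- The double divergence of a Hessian, `∑ ∂ⱼ∂ₖ∂ⱼ∂ₖ u`, is the squared Laplacian of `u`. -/
theorem sum_partialDeriv_four {u : Rn n → 𝕜} (hu : ContDiff ℝ ∞ u) (x : Rn n) :
    ∑ j, ∑ k, partialDeriv j (partialDeriv k (partialDeriv j (partialDeriv k u))) x =
      ∑ j, partialDeriv j (partialDeriv j
        (fun y => ∑ k, partialDeriv k (partialDeriv k u) y)) x := by
  refine Finset.sum_congr rfl fun j _ => ?_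
  have h2 : ∀ k : Fin n, ContDiff ℝ ∞ (partialDeriv k (partialDeriv k u)) := fun k =>
    contDiff_partialDeriv (contDiff_partialDeriv hu k) k
  rw [partialDeriv_sum _ h2, partialDeriv_sum _ fun k => contDiff_partialDeriv (h2 k) j]
  refine Finset.sum_congr rfl fun k _ => ?_
  rw [partialDeriv_comm (contDiff_partialDeriv hu k) k j]

/-- A biharmonic function on the plane that vanishes at infinity along with its second derivatives
is zero. -/
theorem eq_zero_of_biharmonic_of_tendsto {u : Rn 2 → 𝕜} (hu : ContDiff ℝ ∞ u)
    (hΔ : ∀ x, ∑ j, ∑ k,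
      partialDeriv j (partialDeriv k (partialDeriv j (partialDeriv k u))) x = 0)
    (h0 : Tendsto u (cocompact (Rn 2)) (𝓝 0))
    (h2 : ∀ j, Tendsto (partialDeriv j (partialDeriv j u)) (cocompact (Rn 2)) (𝓝 0)) : u = 0 := by
  have hs : ∀ k : Fin 2, ContDiff ℝ ∞ (partialDeriv k (partialDeriv k u)) := fun k =>
    contDiff_partialDeriv (contDiff_partialDeriv hu k) k
  have hw : (fun y => ∑ k, partialDeriv k (partialDeriv k u) y) = 0 := by
    refine eq_zero_of_harmonic_of_tendsto (ContDiff.sum fun k _ => hs k) (fun x => ?_) ?_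
    · rw [← sum_partialDeriv_four hu, hΔ]
    · simpa using tendsto_finsetSum Finset.univ fun k _ => h2 k
  exact eq_zero_of_harmonic_of_tendsto hu (fun x => congrFun hw x) h0

/-- The potentials of two decompositions differ by a biharmonic function. Its Hessian is the
difference of the solenoidal parts, so it vanishes at infinity too. -/
theorem IsDecayingDecomposition.unique {F g g' : TensorField 𝕜 2 2} {v v' : Rn 2 → 𝕜}
    (h : IsDecayingDecomposition F g v) (h' : IsDecayingDecomposition F g' v') :
    g' = g ∧ v' = v := by
  have hd : ∀ i j : Fin 2, partialDeriv i (partialDeriv j (fun x => v' x - v x)) =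
      fun x => g x ![i, j] - g' x ![i, j] := by
    intro i j
    rw [partialDeriv_sub h'.smooth_v h.smooth_v, partialDeriv_sub
      (contDiff_partialDeriv h'.smooth_v j) (contDiff_partialDeriv h.smooth_v j)]
    ext x
    have e1 := h.eq_add x ![i, j]
    have e2 := h'.eq_add x ![i, j]
    simp only [Matrix.cons_val_zero, Matrix.cons_val_one] at e1 e2
    linear_combination e1 - e2
  have hu : (fun x => v' x - v x) = 0 := by
    refine eq_zero_of_biharmonic_of_tendsto (h'.smooth_v.sub h.smooth_v) (fun x => ?_) ?_ ?_
    · simp only [hd]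
      have e1 := h.sum_partialDeriv_eq_zero x
      have e2 := h'.sum_partialDeriv_eq_zero x
      rw [← sub_zero (0 : 𝕜)]
      nth_rw 1 [← e1]
      rw [← e2, ← Finset.sum_sub_distrib]
      refine Finset.sum_congr rfl fun j _ => ?_
      rw [← Finset.sum_sub_distrib]
      refine Finset.sum_congr rfl fun k _ => ?_
      rw [partialDeriv_sub (h.contDiff_component _) (h'.contDiff_component _), partialDeriv_sub
        (contDiff_partialDeriv (h.contDiff_component _) k)
        (contDiff_partialDeriv (h'.contDiff_component _) k)]
    · simpa using h'.tendsto_v.sub h.tendsto_v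
    · intro j
      rw [hd]
      simpa using (tendsto_pi_nhds.1 h.tendsto_g ![j, j]).sub
        (tendsto_pi_nhds.1 h'.tendsto_g ![j, j])
  have hv : v' = v := funext fun x => sub_eq_zero.1 (congrFun hu x)
  subst hv
  refine ⟨funext fun x => funext fun I => ?_, rfl⟩
  have e1 := h.eq_add x I
  rw [h'.eq_add x I] at e1
  exact add_right_cancel e1

end Uniqueness

/-! ### Necessity of the vanishing integrals -/

section Converse
variable {𝕜 : Type*} [RCLike 𝕜] {n : ℕ}

theorem hasCompactSupport_partialDeriv {φ : Rn n → 𝕜} (hφ : HasCompactSupport φ) (i : Fin n) :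
    HasCompactSupport (partialDeriv i φ) :=
  (hφ.fderiv ℝ).comp_left (g := fun T : Rn n →L[ℝ] 𝕜 => T (EuclideanSpace.single i 1)) (by simp)

theorem integral_smul_partialDeriv {φ : Rn n → ℝ} (hφ : ContDiff ℝ ∞ φ)
    (hc : HasCompactSupport φ) {u : Rn n → 𝕜} (hu : ContDiff ℝ ∞ u) (i : Fin n) :
    ∫ x, φ x • partialDeriv i u x = -∫ x, partialDeriv i φ x • u x := by
  refine integral_bilinear_hasFDerivAt_right_eq_neg_left_of_integrable (μ := volume)
    (f := φ) (f' := fderiv ℝ φ) (g := u) (g' := fderiv ℝ u)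
    (v := EuclideanSpace.single i (1 : ℝ)) (B := ContinuousLinearMap.lsmul ℝ ℝ) ?_ ?_ ?_
    (fun x _ => (hφ.differentiable (by simp) x).hasFDerivAt)
    (fun x _ => (hu.differentiable (by simp) x).hasFDerivAt)
  · exact ((contDiff_partialDeriv hφ i).continuous.smul
      hu.continuous).integrable_of_hasCompactSupport
      (hasCompactSupport_partialDeriv hc i).smul_right
  · exact (hφ.continuous.smul
      (contDiff_partialDeriv hu i).continuous).integrable_of_hasCompactSupport hc.smul_right
  · exact (hφ.continuous.smul hu.continuous).integrable_of_hasCompactSupport hc.smul_right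

theorem integral_smul_partialDeriv_two {φ : Rn n → ℝ} (hφ : ContDiff ℝ ∞ φ)
    (hc : HasCompactSupport φ) {u : Rn n → 𝕜} (hu : ContDiff ℝ ∞ u) (i j : Fin n) :
    ∫ x, φ x • partialDeriv i (partialDeriv j u) x =
      ∫ x, partialDeriv j (partialDeriv i φ) x • u x := by
  rw [integral_smul_partialDeriv hφ hc (contDiff_partialDeriv hu j), integral_smul_partialDeriv
    (contDiff_partialDeriv hφ i) (hasCompactSupport_partialDeriv hc i) hu, neg_neg]

/-- Testing a decomposition against the Hessian of a compactly supported function removes the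
solenoidal part. -/
theorem IsDecayingDecomposition.sum_integral_smul {F g : TensorField 𝕜 n 2} {v : Rn n → 𝕜}
    (h : IsDecayingDecomposition F g v) {φ : Rn n → ℝ} (hφ : ContDiff ℝ ∞ φ)
    (hc : HasCompactSupport φ) :
    ∑ j, ∑ k, ∫ x, partialDeriv k (partialDeriv j φ) x • F x ![j, k] =
      ∫ x, (∑ j, ∑ k, partialDeriv k (partialDeriv j (partialDeriv k (partialDeriv j φ))) x)
        • v x := by
  have hs2 : ∀ j k, ContDiff ℝ ∞ (partialDeriv k (partialDeriv j φ)) := fun j k =>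
    contDiff_partialDeriv (contDiff_partialDeriv hφ j) k
  have hc2 : ∀ j k, HasCompactSupport (partialDeriv k (partialDeriv j φ)) := fun j k =>
    hasCompactSupport_partialDeriv (hasCompactSupport_partialDeriv hc j) k
  have hint : ∀ {ψ : Rn n → ℝ} {u : Rn n → 𝕜}, ContDiff ℝ ∞ ψ → HasCompactSupport ψ →
      ContDiff ℝ ∞ u → Integrable (fun x => ψ x • u x) := fun hψ hψc hu =>
    (hψ.continuous.smul hu.continuous).integrable_of_hasCompactSupport hψc.smul_right
  have hv2 : ∀ j k, ContDiff ℝ ∞ (partialDeriv j (partialDeriv k v)) := fun j k =>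
    contDiff_partialDeriv (contDiff_partialDeriv h.smooth_v k) j
  have hg2 : ∀ j k, ContDiff ℝ ∞ (partialDeriv j (partialDeriv k (fun z => g z ![j, k]))) :=
    fun j k => contDiff_partialDeriv (contDiff_partialDeriv (h.contDiff_component _) k) j
  have hsol : ∑ j, ∑ k, ∫ x, partialDeriv k (partialDeriv j φ) x • g x ![j, k] = 0 := by
    simp_rw [← integral_smul_partialDeriv_two hφ hc (h.contDiff_component _)]
    simp_rw [← integral_finsetSum Finset.univ fun k _ => hint hφ hc (hg2 _ k)]
    rw [← integral_finsetSum Finset.univ fun j _ =>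
      integrable_finsetSum Finset.univ fun k _ => hint hφ hc (hg2 j k)]
    simp_rw [← Finset.smul_sum, h.sum_partialDeriv_eq_zero]
    simp
  have hpot : ∀ j k, ∫ x, partialDeriv k (partialDeriv j φ) x •
      partialDeriv j (partialDeriv k v) x =
      ∫ x, partialDeriv k (partialDeriv j (partialDeriv k (partialDeriv j φ))) x • v x :=
    fun j k => integral_smul_partialDeriv_two (hs2 j k) (hc2 j k) h.smooth_v j k
  have hi4 : ∀ j k, Integrable (fun x =>
      partialDeriv k (partialDeriv j (partialDeriv k (partialDeriv j φ))) x • v x) := fun j k =>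
    hint (contDiff_partialDeriv (contDiff_partialDeriv (hs2 j k) j) k)
      (hasCompactSupport_partialDeriv (hasCompactSupport_partialDeriv (hc2 j k) j) k) h.smooth_v
  simp_rw [Finset.sum_smul]
  rw [integral_finsetSum Finset.univ fun j _ =>
      integrable_finsetSum Finset.univ fun k _ => hi4 j k]
  simp_rw [integral_finsetSum Finset.univ fun k _ => hi4 _ k, ← hpot]
  refine Eq.trans ?_ (zero_add _)
  rw [← hsol, ← Finset.sum_add_distrib]
  refine Finset.sum_congr rfl fun j _ => ?_
  rw [← Finset.sum_add_distrib]
  refine Finset.sum_congr rfl fun k _ => ?_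
  rw [← integral_add (hint (hs2 j k) (hc2 j k) (h.contDiff_component _))
    (hint (hs2 j k) (hc2 j k) (hv2 j k))]
  congr 1 with x
  rw [h.eq_add x ![j, k], smul_add]
  rfl

theorem partialDeriv_comp_smul (t : ℝ) (φ : Rn n → 𝕜) (i : Fin n) :
    partialDeriv i (fun x => φ (t • x)) = fun x => t • partialDeriv i φ (t • x) := by
  ext x
  unfold partialDeriv
  rw [fderiv_comp_smul]
  rfl

theorem partialDeriv_const_smul (t : ℝ) {φ : Rn n → 𝕜} (hφ : ContDiff ℝ ∞ φ) (i : Fin n) :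
    partialDeriv i (fun x => t • φ x) = fun x => t • partialDeriv i φ x := by
  ext x
  unfold partialDeriv
  rw [fderiv_fun_const_smul (hφ.differentiable (by simp) x)]
  rfl

theorem partialDeriv_two_comp_smul (t : ℝ) {φ : Rn n → 𝕜} (hφ : ContDiff ℝ ∞ φ) (i j : Fin n) :
    partialDeriv i (partialDeriv j (fun x => φ (t • x))) =
      fun x => t ^ 2 • partialDeriv i (partialDeriv j φ) (t • x) := by
  have hc : ContDiff ℝ ∞ (fun x : Rn n => partialDeriv j φ (t • x)) :=
    (contDiff_partialDeriv hφ j).comp (contDiff_const_smul t)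
  rw [partialDeriv_comp_smul, partialDeriv_const_smul t hc, partialDeriv_comp_smul]
  ext x
  rw [smul_smul, sq]

/-- Testing a decomposition at larger and larger scales: with `χ(t x)` as the test function, the
side of the field tends, after division by `t²`, to the Hessian of `χ` at the origin paired with the
integrals of the components, while the side of the potential tends to zero as `t → 0` because the
potential vanishes at infinity. -/
theorem IsDecayingDecomposition.sum_hessian_smul_integral {F g : TensorField 𝕜 2 2}
    {v : Rn 2 → 𝕜} (h : IsDecayingDecomposition F g v) (hF : ∀ I, Integrable (fun x => F x I))
    {χ : Rn 2 → ℝ} (hχ : ContDiff ℝ ∞ χ) (hc : HasCompactSupport χ) :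
    ∑ j, ∑ k, partialDeriv k (partialDeriv j χ) 0 • ∫ x, F x ![j, k] = 0 := by
  set Ψ : Rn 2 → ℝ := fun x =>
    ∑ j, ∑ k, partialDeriv k (partialDeriv j (partialDeriv k (partialDeriv j χ))) x with hΨ
  have hs2 : ∀ j k, ContDiff ℝ ∞ (partialDeriv k (partialDeriv j χ)) := fun j k =>
    contDiff_partialDeriv (contDiff_partialDeriv hχ j) k
  have hc2 : ∀ j k, HasCompactSupport (partialDeriv k (partialDeriv j χ)) := fun j k =>
    hasCompactSupport_partialDeriv (hasCompactSupport_partialDeriv hc j) k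
  have hs4 : ∀ j k, ContDiff ℝ ∞
      (partialDeriv k (partialDeriv j (partialDeriv k (partialDeriv j χ)))) := fun j k =>
    contDiff_partialDeriv (contDiff_partialDeriv (hs2 j k) j) k
  have hΨint : Integrable Ψ := integrable_finsetSum _ fun j _ => integrable_finsetSum _ fun k _ =>
    (hs4 j k).continuous.integrable_of_hasCompactSupport
      (hasCompactSupport_partialDeriv (hasCompactSupport_partialDeriv (hc2 j k) j) k)
  have hΨcont : Continuous Ψ := continuous_finsetSum _ fun j _ => continuous_finsetSum _ fun k _ =>
    (hs4 j k).continuous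
  obtain ⟨M, hM⟩ : ∃ M, ∀ x, ‖v x‖ ≤ M := by
    obtain ⟨M, hM⟩ := (ZeroAtInftyContinuousMap.isBounded_range
      (⟨⟨v, h.smooth_v.continuous⟩, h.tendsto_v⟩ :
        ZeroAtInftyContinuousMap (Rn 2) 𝕜)).exists_norm_le
    exact ⟨M, fun x => hM _ ⟨x, rfl⟩⟩
  -- the identity tested against `χ (t • x)`, after the change of variables `y = t • x`
  have hscale : ∀ t : ℝ, 0 < t →
      ∑ j, ∑ k, ∫ x, partialDeriv k (partialDeriv j χ) (t • x) • F x ![j, k] =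
        ∫ y, Ψ y • v (t⁻¹ • y) := by
    intro t ht
    have h1 := h.sum_integral_smul (φ := fun x => χ (t • x))
      (hχ.comp (contDiff_const_smul t)) (hc.comp_smul ht.ne')
    have e2 : ∀ i j, partialDeriv i (partialDeriv j (fun x => χ (t • x))) =
      fun x => t ^ 2 • partialDeriv i (partialDeriv j χ) (t • x) := fun i j =>
        partialDeriv_two_comp_smul t hχ i j
    have e4 : ∀ i j x, partialDeriv i (partialDeriv j
        (partialDeriv i (partialDeriv j (fun x => χ (t • x))))) x =
        t ^ 4 * partialDeriv i (partialDeriv j (partialDeriv i (partialDeriv j χ))) (t • x) := by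
      intro i j x
      have hcs : ContDiff ℝ ∞ (fun x : Rn 2 => partialDeriv i (partialDeriv j χ) (t • x)) :=
        (hs2 j i).comp (contDiff_const_smul t)
      rw [e2, partialDeriv_const_smul _ hcs,
        partialDeriv_const_smul _ (contDiff_partialDeriv hcs j),
        partialDeriv_two_comp_smul t (hs2 j i)]
      simp only [smul_eq_mul]
      ring
    simp_rw [e4, ← Finset.mul_sum, e2] at h1
    -- the Jacobian `t⁻²` of the plane turns the factor `t⁴` into `t²`
    have h3 : ∫ x, (t ^ 4 * Ψ (t • x)) • v x = t ^ 2 • ∫ y, Ψ y • v (t⁻¹ • y) := by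
      have := Measure.integral_comp_smul (volume : Measure (Rn 2))
        (fun y => Ψ y • v (t⁻¹ • y)) t
      simp only [smul_smul, inv_mul_cancel₀ ht.ne', one_smul, finrank_euclideanSpace_fin] at this
      simp_rw [mul_smul, integral_smul]
      rw [this, smul_smul, abs_of_pos (by positivity)]
      congr 1
      field_simp
    rw [h3] at h1
    simp_rw [smul_eq_mul, mul_smul, integral_smul, ← Finset.smul_sum] at h1
    exact smul_right_injective 𝕜 (pow_ne_zero 2 ht.ne') h1
  have hlim1 : Tendsto (fun t : ℝ =>
      ∑ j, ∑ k, ∫ x, partialDeriv k (partialDeriv j χ) (t • x) • F x ![j, k]) (𝓝[>] 0)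
      (𝓝 (∑ j, ∑ k, partialDeriv k (partialDeriv j χ) 0 • ∫ x, F x ![j, k])) := by
    refine tendsto_finsetSum _ fun j _ => tendsto_finsetSum _ fun k _ => ?_
    obtain ⟨D, hD⟩ := (hc2 j k).exists_bound_of_continuous (hs2 j k).continuous
    rw [← integral_smul]
    refine tendsto_integral_filter_of_dominated_convergence (fun x => D * ‖F x ![j, k]‖)
      (Eventually.of_forall fun t => ?_) (Eventually.of_forall fun t => Eventually.of_forall
        fun x => ?_) ((hF _).norm.const_mul D) (Eventually.of_forall fun x => ?_)
    · exact ((hs2 j k).continuous.comp (continuous_const_smul t)).aestronglyMeasurable.smul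
        (hF _).aestronglyMeasurable
    · rw [norm_smul]
      gcongr
      exact hD _
    · have : Tendsto (fun t : ℝ => partialDeriv k (partialDeriv j χ) (t • x)) (𝓝 0)
          (𝓝 (partialDeriv k (partialDeriv j χ) ((0 : ℝ) • x))) :=
        ((hs2 j k).continuous.comp (continuous_id.smul continuous_const)).tendsto _
      rw [zero_smul] at this
      exact (this.mono_left nhdsWithin_le_nhds).smul_const _
  have hlim2 : Tendsto (fun t : ℝ => ∫ y, Ψ y • v (t⁻¹ • y)) (𝓝[>] 0) (𝓝 0) := by
    have : (0 : 𝕜) = ∫ _ : Rn 2, (0 : 𝕜) := by simp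
    rw [this]
    refine tendsto_integral_filter_of_dominated_convergence (fun x => ‖Ψ x‖ * M)
      (Eventually.of_forall fun t => ?_) (Eventually.of_forall fun t => Eventually.of_forall
        fun x => ?_) (hΨint.norm.mul_const M) ?_
    · exact (hΨcont.smul (h.smooth_v.continuous.comp
        (continuous_const_smul _))).aestronglyMeasurable
    · rw [norm_smul]
      gcongr
      exact hM _
    · filter_upwards [Measure.ae_ne volume (0 : Rn 2)] with y hy
      have h1 : Tendsto (fun t : ℝ => t⁻¹ • y) (𝓝[>] 0) (cocompact (Rn 2)) := by
        rw [← Metric.cobounded_eq_cocompact, ← tendsto_norm_atTop_iff_cobounded]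
        simp_rw [norm_smul]
        exact (tendsto_norm_cobounded_atTop.comp
          ((tendsto_inv₀_nhdsNE_zero (α := ℝ)).mono_left
            (nhdsWithin_mono _ fun _ h => ne_of_gt h))).atTop_mul_const (norm_pos_iff.2 hy)
      simpa using (h.tendsto_v.comp h1).const_smul (Ψ y)
  refine tendsto_nhds_unique hlim1 (hlim2.congr' ?_)
  filter_upwards [self_mem_nhdsWithin] with t ht using (hscale t ht).symm

theorem partialDeriv_coord (i a : Fin n) (x : Rn n) :
    partialDeriv i (fun y : Rn n => y a) x = if i = a then 1 else 0 := by
  have : HasFDerivAt (fun y : Rn n => y a) (EuclideanSpace.proj a : Rn n →L[ℝ] ℝ) x :=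
    (EuclideanSpace.proj a : Rn n →L[ℝ] ℝ).hasFDerivAt
  unfold partialDeriv
  rw [this.fderiv]
  simp [eq_comm]

theorem contDiff_coord (a : Fin n) : ContDiff ℝ ∞ (fun y : Rn n => y a) :=
  (EuclideanSpace.proj a : Rn n →L[ℝ] ℝ).contDiff

theorem partialDeriv_mul {g h : Rn n → ℝ} {x : Rn n} (hg : DifferentiableAt ℝ g x)
    (hh : DifferentiableAt ℝ h x) (i : Fin n) :
    partialDeriv i (fun x => g x * h x) x =
      partialDeriv i g x * h x + g x * partialDeriv i h x := by
  unfold partialDeriv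
  rw [fderiv_fun_mul hg hh]
  simp
  ring

theorem partialDeriv_congr_of_eventuallyEq {g h : Rn n → 𝕜} {x : Rn n} (e : g =ᶠ[𝓝 x] h)
    (i : Fin n) : partialDeriv i g =ᶠ[𝓝 x] partialDeriv i h := by
  filter_upwards [e.fderiv (𝕜 := ℝ)] with y hy
  unfold partialDeriv
  rw [hy]

/-- For every pair of indices there is a compactly supported smooth function that agrees with
`xₐ x_b` near the origin. -/
theorem exists_hessian_eq (a b : Fin n) : ∃ χ : Rn n → ℝ, ContDiff ℝ ∞ χ ∧ HasCompactSupport χ ∧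
    ∀ i j, partialDeriv i (partialDeriv j χ) 0 =
      (if j = a then 1 else 0) * (if i = b then 1 else 0) +
      (if i = a then 1 else 0) * (if j = b then 1 else 0) := by
  let η : ContDiffBump (0 : Rn n) := ⟨1, 2, one_pos, one_lt_two⟩
  refine ⟨fun x => x a * x b * η x, ((contDiff_coord a).mul (contDiff_coord b)).mul η.contDiff,
    η.hasCompactSupport.mul_left, fun i j => ?_⟩
  have e : (fun x : Rn n => x a * x b * η x) =ᶠ[𝓝 0] fun x => x a * x b := by
    filter_upwards [η.eventuallyEq_one] with x hx
    simp [hx]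
  have hd : ∀ (c : Fin n) (x : Rn n), DifferentiableAt ℝ (fun y : Rn n => y c) x := fun c x =>
    (contDiff_coord c).differentiable (by simp) x
  rw [(partialDeriv_congr_of_eventuallyEq (partialDeriv_congr_of_eventuallyEq e j) i).eq_of_nhds]
  have h1 : partialDeriv j (fun x : Rn n => x a * x b) =
      fun x => (if j = a then 1 else 0) * x b + x a * (if j = b then 1 else 0) := by
    ext x
    rw [partialDeriv_mul (hd a x) (hd b x), partialDeriv_coord, partialDeriv_coord]
  rw [h1, partialDeriv_add (contDiff_const.mul (contDiff_coord b))
    ((contDiff_coord a).mul contDiff_const)]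
  simp only
  rw [partialDeriv_mul (differentiableAt_const _) (hd b 0),
    partialDeriv_mul (hd a 0) (differentiableAt_const _), partialDeriv_coord, partialDeriv_coord]
  simp

/-- A decaying decomposition forces the integral of an integrable symmetric field to vanish:
the Hessians at the origin of the functions `xₐ x_b` span all symmetric matrices. -/
theorem IsDecayingDecomposition.integral_eq_zero {F g : TensorField 𝕜 2 2}
    {v : Rn 2 → 𝕜} (h : IsDecayingDecomposition F g v) (hF : ∀ I, Integrable (fun x => F x I))
    (hsymm : IsSymmetric F) (I : Fin 2 → Fin 2) : ∫ x, F x I = 0 := by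
  obtain ⟨χ, hχ, hc, hχ2⟩ := exists_hessian_eq (I 0) (I 1)
  have key := h.sum_hessian_smul_integral hF hχ hc
  simp_rw [hχ2] at key
  have hs : ∫ x, F x ![I 1, I 0] = ∫ x, F x ![I 0, I 1] := by
    congr 1 with x
    rw [← hsymm x (Equiv.swap 0 1) ![I 0, I 1]]
    congr 1
    ext i
    fin_cases i <;> simp
  have hI : ![I 0, I 1] = I := by
    ext i
    fin_cases i <;> simp
  simp only [add_smul, Finset.sum_add_distrib, mul_smul, ite_smul, one_smul, zero_smul,
    Finset.sum_ite_eq', Finset.mem_univ, if_true] at key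
  simp at key
  rw [hs, hI, ← two_mul] at key
  simpa using key

end Converse
/-! ### Polynomially bounded functions -/

section PolyBdd
variable {n : ℕ}

theorem PolyBdd.of_le {G G' : Type*} [NormedAddCommGroup G] [NormedAddCommGroup G']
    {K : Rn n → G} {L : Rn n → G'} (hL : PolyBdd L) (h : ∀ x, ‖K x‖ ≤ ‖L x‖) : PolyBdd K := by
  obtain ⟨C, k, hC⟩ := hL
  exact ⟨C, k, fun x => (h x).trans (hC x)⟩

theorem polyBdd_const (c : ℝ) : PolyBdd (fun _ : Rn n => c) := ⟨‖c‖, 0, fun x => by simp⟩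

theorem polyBdd_norm : PolyBdd (fun x : Rn n => ‖x‖) := ⟨1, 1, fun x => by simp⟩

theorem polyBdd_coord (i : Fin n) : PolyBdd (fun x : Rn n => x i) :=
  polyBdd_norm.of_le fun x => by simpa using PiLp.norm_apply_le x i

theorem PolyBdd.mul {K L : Rn n → ℝ} (hK : PolyBdd K) (hL : PolyBdd L) :
    PolyBdd (fun x => K x * L x) := by
  obtain ⟨C, k, hC⟩ := hK
  obtain ⟨D, l, hD⟩ := hL
  refine ⟨C * D, k + l, fun x => ?_⟩
  rw [norm_mul, pow_add, mul_mul_mul_comm]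
  exact mul_le_mul (hC x) (hD x) (norm_nonneg _) ((norm_nonneg _).trans (hC x))

theorem PolyBdd.add {G : Type*} [NormedAddCommGroup G] {K L : Rn n → G} (hK : PolyBdd K)
    (hL : PolyBdd L) : PolyBdd (fun x => K x + L x) := by
  obtain ⟨C, k, hC⟩ := hK
  obtain ⟨D, l, hD⟩ := hL
  have hC0 : 0 ≤ C := by simpa using (norm_nonneg _).trans (hC 0)
  have hD0 : 0 ≤ D := by simpa using (norm_nonneg _).trans (hD 0)
  refine ⟨C + D, k + l, fun x => (norm_add_le _ _).trans ?_⟩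
  rw [add_mul]
  have h1 : 1 ≤ 1 + ‖x‖ := by linarith [norm_nonneg x]
  gcongr
  · exact (hC x).trans (by gcongr; simp)
  · exact (hD x).trans (by gcongr; simp)

theorem PolyBdd.sum {ι : Type*} (s : Finset ι) {K : ι → Rn n → ℝ}
    (hK : ∀ i, PolyBdd (K i)) : PolyBdd (fun x => ∑ i ∈ s, K i x) := by
  classical
  induction s using Finset.induction_on with
  | empty => simpa using polyBdd_const 0
  | insert a s ha ih => simpa [Finset.sum_insert ha] using (hK a).add ih

/-- A differentiable function with polynomially bounded partial derivatives is polynomially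
bounded. -/
theorem PolyBdd.of_partialDeriv {K : Rn n → ℝ} (hd : Differentiable ℝ K)
    (hK : ∀ i, PolyBdd (partialDeriv i K)) : PolyBdd K := by
  obtain ⟨C, k, hC⟩ := PolyBdd.sum Finset.univ fun i =>
    (hK i).of_le (K := fun x => ‖partialDeriv i K x‖) (fun x => by simp)
  have hC' : ∀ x, ‖fderiv ℝ K x‖ ≤ C * (1 + ‖x‖) ^ k := fun x =>
    (norm_fderiv_le_sum_partialDeriv K x).trans ((le_abs_self _).trans (hC x))
  have hC0 : 0 ≤ C := by simpa using (norm_nonneg _).trans (hC 0)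
  have hpow : PolyBdd (fun x : Rn n => C * (1 + ‖x‖) ^ k) :=
    ⟨C, k, fun x => by rw [Real.norm_of_nonneg (by positivity)]⟩
  refine PolyBdd.of_le (L := fun x : Rn n => C * (1 + ‖x‖) ^ k * ‖x‖ + ‖K 0‖)
    ((hpow.mul polyBdd_norm).add (polyBdd_const _)) fun x => ?_
  · have h1 := (convex_closedBall (0 : Rn n) ‖x‖).norm_image_sub_le_of_norm_fderiv_le (𝕜 := ℝ)
      (f := K) (C := C * (1 + ‖x‖) ^ k) (x := 0) (y := x) (fun y _ => hd y) (fun y hy => ?_)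
      (by simp) (by simp)
    · refine le_trans ?_ (le_abs_self _)
      have h2 := norm_le_norm_add_norm_sub' (K x) (K 0)
      rw [sub_zero] at h1
      linarith
    · refine (hC' y).trans ?_
      have : ‖y‖ ≤ ‖x‖ := by simpa using hy
      gcongr

end PolyBdd

/-! ### The fundamental solution of the squared Laplacian -/

section Kernel
variable {𝕜 : Type*} [RCLike 𝕜] {n : ℕ}

/-- The Laplacian of a Schwartz function, as a Schwartz function. -/
noncomputable def schwartzLaplacian (φ : SchwartzMap (Rn n) 𝕜) : SchwartzMap (Rn n) 𝕜 :=
  ∑ j, schwartzPartial j (schwartzPartial j φ)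

theorem conv_schwartzLaplacian {K : Rn n → ℝ} (hs : ContDiff ℝ ∞ K) (hK : PolyBdd K)
    (hK1 : ∀ j, PolyBdd (partialDeriv j K))
    (hK2 : ∀ j, PolyBdd (partialDeriv j (partialDeriv j K))) (φ : SchwartzMap (Rn n) 𝕜) :
    conv K (schwartzLaplacian φ) = conv (fun x => ∑ j, partialDeriv j (partialDeriv j K) x) φ := by
  have h1 : ∀ j, ContDiff ℝ ∞ (partialDeriv j K) := contDiff_partialDeriv hs
  have h2 : ∀ j, ContDiff ℝ ∞ (partialDeriv j (partialDeriv j K)) := fun j =>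
    contDiff_partialDeriv (h1 j) j
  ext x
  unfold schwartzLaplacian
  rw [conv_sum _ hK hs.continuous.aestronglyMeasurable]
  have e : ∀ j, conv K (schwartzPartial j (schwartzPartial j φ)) x =
      conv (partialDeriv j (partialDeriv j K)) φ x := by
    intro j
    rw [conv_schwartzPartial hK (hs.differentiable (by simp)) (hK1 j)
      (h1 j).continuous.aestronglyMeasurable, conv_schwartzPartial (hK1 j)
      ((h1 j).differentiable (by simp)) (hK2 j) (h2 j).continuous.aestronglyMeasurable]
  simp_rw [e]
  unfold conv
  rw [← integral_finsetSum _ fun j _ => integrable_conv_integrand (hK2 j)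
    (h2 j).continuous.aestronglyMeasurable φ x]
  simp_rw [Finset.sum_smul]

/-- `a + |x|²`. -/
noncomputable def shiftedNormSq (a : ℝ) (x : Rn n) : ℝ := a + ‖x‖ ^ 2

theorem shiftedNormSq_pos {a : ℝ} (ha : 0 < a) (x : Rn n) : 0 < shiftedNormSq a x := by
  unfold shiftedNormSq
  positivity

theorem contDiff_shiftedNormSq (a : ℝ) : ContDiff ℝ ∞ (shiftedNormSq (n := n) a) :=
  contDiff_const.add (contDiff_norm_sq ℝ)

theorem sum_coord_sq (x : Rn n) : ∑ i, x i ^ 2 = ‖x‖ ^ 2 := by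
  rw [EuclideanSpace.norm_sq_eq]
  simp

/-- The chain rule for functions of `a + |x|²`. -/
theorem partialDeriv_comp_shiftedNormSq {G : ℝ → ℝ} {G' : ℝ} {a : ℝ} {x : Rn n}
    (hG : HasDerivAt G G' (shiftedNormSq a x)) (i : Fin n) :
    partialDeriv i (fun y => G (shiftedNormSq a y)) x = G' * (2 * x i) := by
  have h1 : HasFDerivAt (shiftedNormSq (n := n) a) (2 • innerSL ℝ x) x :=
    ((hasStrictFDerivAt_norm_sq x).hasFDerivAt).const_add a
  have h2 := hG.hasFDerivAt.comp x h1
  unfold partialDeriv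
  rw [show (fun y => G (shiftedNormSq a y)) = G ∘ shiftedNormSq a from rfl, h2.fderiv]
  simp [EuclideanSpace.inner_single_right]
  ring

/-- The regularized biharmonic kernel `(a + |x|²) log (a + |x|²)`. For `a = 0` it is a multiple of
the fundamental solution of the squared Laplacian on the plane. -/
noncomputable def biharmonicKernel (a : ℝ) (x : Rn n) : ℝ :=
  shiftedNormSq a x * Real.log (shiftedNormSq a x)

theorem partialDeriv_biharmonicKernel {a : ℝ} {x : Rn n} (hx : shiftedNormSq a x ≠ 0)
    (i : Fin n) :
    partialDeriv i (biharmonicKernel a) x = (Real.log (shiftedNormSq a x) + 1) * (2 * x i) :=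
  partialDeriv_comp_shiftedNormSq (G := fun s => s * Real.log s) (Real.hasDerivAt_mul_log hx) i

theorem partialDeriv_partialDeriv_biharmonicKernel {a : ℝ} {x : Rn n}
    (hx : shiftedNormSq a x ≠ 0) (i j : Fin n) :
    partialDeriv i (partialDeriv j (biharmonicKernel a)) x =
      (if i = j then 2 else 0) * (Real.log (shiftedNormSq a x) + 1) +
        4 * x i * x j * (shiftedNormSq a x)⁻¹ := by
  have e : partialDeriv j (biharmonicKernel a) =ᶠ[𝓝 x]
      fun y => (Real.log (shiftedNormSq a y) + 1) * (2 * y j) := by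
    filter_upwards [(contDiff_shiftedNormSq a).continuous.continuousAt.eventually_ne hx] with y hy
    exact partialDeriv_biharmonicKernel hy j
  have h1 : HasDerivAt (fun s => Real.log s + 1) (shiftedNormSq a x)⁻¹ (shiftedNormSq a x) :=
    (Real.hasDerivAt_log hx).add_const 1
  have hd : DifferentiableAt ℝ (fun y => Real.log (shiftedNormSq a y) + 1) x :=
    h1.differentiableAt.comp x ((contDiff_shiftedNormSq a).differentiable (by simp) x)
  have hc : ContDiff ℝ ∞ (fun y : Rn n => 2 * y j) := contDiff_const.mul (contDiff_coord j)
  have e2 : partialDeriv i (fun y : Rn n => 2 * y j) x = if i = j then 2 else 0 := by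
    rw [partialDeriv_mul (differentiableAt_const _)
      ((contDiff_coord j).differentiable (by simp) x), partialDeriv_coord]
    simp [partialDeriv]
  rw [(partialDeriv_congr_of_eventuallyEq e i).eq_of_nhds,
    partialDeriv_mul hd (hc.differentiable (by simp) x), e2,
    partialDeriv_comp_shiftedNormSq (G := fun s => Real.log s + 1) h1]
  ring

theorem contDiff_biharmonicKernel {a : ℝ} (ha : 0 < a) :
    ContDiff ℝ ∞ (biharmonicKernel (n := n) a) :=
  (contDiff_shiftedNormSq a).mul
    ((contDiff_shiftedNormSq a).log fun x => (shiftedNormSq_pos ha x).ne')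

theorem polyBdd_shiftedNormSq (a : ℝ) : PolyBdd (shiftedNormSq (n := n) a) :=
  (polyBdd_const a).add ((polyBdd_norm.mul polyBdd_norm).of_le fun x => by simp [sq])

theorem polyBdd_inv_shiftedNormSq {a : ℝ} (ha : 0 < a) :
    PolyBdd (fun x : Rn n => (shiftedNormSq a x)⁻¹) :=
  (polyBdd_const a⁻¹).of_le fun x => by
    rw [Real.norm_of_nonneg (inv_nonneg.2 (shiftedNormSq_pos ha x).le),
      Real.norm_of_nonneg (by positivity)]
    gcongr
    unfold shiftedNormSq
    linarith [sq_nonneg ‖x‖]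

theorem polyBdd_log_shiftedNormSq {a : ℝ} (ha : 0 < a) :
    PolyBdd (fun x : Rn n => Real.log (shiftedNormSq a x)) :=
  ((polyBdd_shiftedNormSq a).add (polyBdd_inv_shiftedNormSq ha)).of_le fun x => by
    have hp := shiftedNormSq_pos ha x
    have hi := inv_pos.2 hp
    rw [Real.norm_of_nonneg (add_pos hp hi).le, Real.norm_eq_abs, abs_le]
    have h1 := Real.log_le_sub_one_of_pos hp
    have h2 := Real.log_le_sub_one_of_pos hi
    rw [Real.log_inv] at h2
    constructor <;> linarith

/-- The regularized kernel is mapped by the squared Laplacian to `32 a² / (a + |x|²)³`. -/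
theorem conv_biharmonicKernel_bilaplacian {a : ℝ} (ha : 0 < a) (φ : SchwartzMap (Rn 2) 𝕜) :
    conv (biharmonicKernel a) (schwartzLaplacian (schwartzLaplacian φ)) =
      conv (fun x => 32 * a ^ 2 * ((shiftedNormSq a x) ^ 3)⁻¹) φ := by
  have hne : ∀ x : Rn 2, shiftedNormSq a x ≠ 0 := fun x => (shiftedNormSq_pos ha x).ne'
  have hlog := polyBdd_log_shiftedNormSq (n := 2) ha
  have hinv := polyBdd_inv_shiftedNormSq (n := 2) ha
  have hE1 : ∀ i, partialDeriv i (biharmonicKernel (n := 2) a) =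
      fun x => (Real.log (shiftedNormSq a x) + 1) * (2 * x i) :=
    fun i => funext fun x => partialDeriv_biharmonicKernel (hne x) i
  have hE2 : ∀ i, partialDeriv i (partialDeriv i (biharmonicKernel (n := 2) a)) =
      fun x => 2 * (Real.log (shiftedNormSq a x) + 1) + 4 * x i * x i * (shiftedNormSq a x)⁻¹ :=
    fun i => funext fun x => by
      rw [partialDeriv_partialDeriv_biharmonicKernel (hne x) i i, if_pos rfl]
  rw [conv_schwartzLaplacian (contDiff_biharmonicKernel ha)
    ((polyBdd_shiftedNormSq a).mul hlog)
    (fun j => by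
      rw [hE1]
      exact (hlog.add (polyBdd_const 1)).mul ((polyBdd_const 2).mul (polyBdd_coord j)))
    (fun j => by
      rw [hE2]
      exact ((polyBdd_const 2).mul (hlog.add (polyBdd_const 1))).add
        ((((polyBdd_const 4).mul (polyBdd_coord j)).mul (polyBdd_coord j)).mul hinv))]
  -- with `s = a + |x|²`, one has `Δ (s log s) = 4 log s + 8 - 4 a / s` in dimension two
  have hL : (fun x => ∑ j, partialDeriv j (partialDeriv j (biharmonicKernel (n := 2) a)) x) =
      fun x => 4 * Real.log (shiftedNormSq a x) + 8 + (-4 * a) * (shiftedNormSq a x)⁻¹ := by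
    ext x
    simp only [hE2, Fin.sum_univ_two]
    have hs := sum_coord_sq x
    rw [Fin.sum_univ_two] at hs
    have hq : shiftedNormSq a x = a + (x 0 ^ 2 + x 1 ^ 2) := by rw [hs]; rfl
    have hne' := hne x
    rw [hq] at hne' ⊢
    field_simp
    ring
  rw [hL]
  have hLs : ContDiff ℝ ∞ (fun x : Rn 2 => 4 * Real.log (shiftedNormSq a x) + 8 +
      (-4 * a) * (shiftedNormSq a x)⁻¹) :=
    ((contDiff_const.mul ((contDiff_shiftedNormSq a).log hne)).add contDiff_const).add
      (contDiff_const.mul ((contDiff_shiftedNormSq a).inv hne))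
  have hL1 : ∀ i, partialDeriv i (fun x : Rn 2 => 4 * Real.log (shiftedNormSq a x) + 8 +
      (-4 * a) * (shiftedNormSq a x)⁻¹) =
      fun x => (4 * (shiftedNormSq a x)⁻¹ +
        4 * a * ((shiftedNormSq a x)⁻¹ * (shiftedNormSq a x)⁻¹)) * (2 * x i) := by
    intro i
    ext x
    have hG : HasDerivAt (fun s => 4 * Real.log s + 8 + (-4 * a) * s⁻¹)
        (4 * (shiftedNormSq a x)⁻¹ + (-4 * a) * -((shiftedNormSq a x) ^ 2)⁻¹)
        (shiftedNormSq a x) :=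
      (((Real.hasDerivAt_log (hne x)).const_mul 4).add_const 8).add
        ((hasDerivAt_inv (hne x)).const_mul _)
    rw [partialDeriv_comp_shiftedNormSq
      (G := fun s => 4 * Real.log s + 8 + (-4 * a) * s⁻¹) hG, sq, mul_inv]
    ring
  have hL2 : ∀ i, partialDeriv i (partialDeriv i (fun x : Rn 2 =>
      4 * Real.log (shiftedNormSq a x) + 8 + (-4 * a) * (shiftedNormSq a x)⁻¹)) =
      fun x => (-4 * ((shiftedNormSq a x)⁻¹ * (shiftedNormSq a x)⁻¹) + (-8 * a) *
        ((shiftedNormSq a x)⁻¹ * ((shiftedNormSq a x)⁻¹ * (shiftedNormSq a x)⁻¹))) *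
          (2 * x i) * (2 * x i) +
        (4 * (shiftedNormSq a x)⁻¹ +
          4 * a * ((shiftedNormSq a x)⁻¹ * (shiftedNormSq a x)⁻¹)) * 2 := by
    intro i
    rw [hL1]
    ext x
    have hinvd := hasDerivAt_inv (hne x)
    have hG : HasDerivAt (fun s : ℝ => 4 * s⁻¹ + 4 * a * (s⁻¹ * s⁻¹)) _ (shiftedNormSq a x) :=
      (hinvd.const_mul 4).add ((hinvd.mul hinvd).const_mul (4 * a))
    have hd : DifferentiableAt ℝ (fun y : Rn 2 => 4 * (shiftedNormSq a y)⁻¹ +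
        4 * a * ((shiftedNormSq a y)⁻¹ * (shiftedNormSq a y)⁻¹)) x :=
      hG.differentiableAt.comp x ((contDiff_shiftedNormSq a).differentiable (by simp) x)
    have hc : ContDiff ℝ ∞ (fun y : Rn 2 => 2 * y i) := contDiff_const.mul (contDiff_coord i)
    have e2 : partialDeriv i (fun y : Rn 2 => 2 * y i) x = 2 := by
      rw [partialDeriv_mul (differentiableAt_const _)
        ((contDiff_coord i).differentiable (by simp) x), partialDeriv_coord]
      simp [partialDeriv]
    rw [partialDeriv_mul hd (hc.differentiable (by simp) x), e2,
      partialDeriv_comp_shiftedNormSq (G := fun s => 4 * s⁻¹ + 4 * a * (s⁻¹ * s⁻¹)) hG]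
    have := hne x
    field_simp
    ring
  rw [conv_schwartzLaplacian hLs
    ((((polyBdd_const 4).mul hlog).add (polyBdd_const 8)).add ((polyBdd_const _).mul hinv))
    (fun j => by
      rw [hL1]
      exact (((polyBdd_const 4).mul hinv).add ((polyBdd_const (4 * a)).mul (hinv.mul hinv))).mul
        ((polyBdd_const 2).mul (polyBdd_coord j)))
    (fun j => by
      rw [hL2]
      exact (((((polyBdd_const (-4)).mul (hinv.mul hinv)).add ((polyBdd_const (-8 * a)).mul
        (hinv.mul (hinv.mul hinv)))).mul ((polyBdd_const 2).mul (polyBdd_coord j))).mul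
          ((polyBdd_const 2).mul (polyBdd_coord j))).add
        ((((polyBdd_const 4).mul hinv).add ((polyBdd_const (4 * a)).mul (hinv.mul hinv))).mul
          (polyBdd_const 2)))]
  -- the second Laplacian: `Δ (4 log s + 8 - 4 a / s) = 32 a² / s³`
  congr 1
  ext x
  simp only [hL2, Fin.sum_univ_two]
  have hs := sum_coord_sq x
  rw [Fin.sum_univ_two] at hs
  have hq : shiftedNormSq a x = a + (x 0 ^ 2 + x 1 ^ 2) := by rw [hs]; rfl
  have hne' := hne x
  rw [hq] at hne' ⊢
  field_simp
  ring

theorem abs_mul_log_le {s : ℝ} (hs : 0 ≤ s) : |s * Real.log s| ≤ 1 + s ^ 2 := by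
  rcases hs.eq_or_lt with rfl | hp
  · simp
  · have h1 := Real.log_le_sub_one_of_pos hp
    have h2 := Real.log_le_sub_one_of_pos (inv_pos.2 hp)
    rw [Real.log_inv] at h2
    have h3 : s * s⁻¹ = 1 := mul_inv_cancel₀ hp.ne'
    rw [abs_le]
    constructor <;> nlinarith

/-- A bound on the regularized kernel that is uniform in the regularization. -/
theorem abs_biharmonicKernel_le {a : ℝ} (ha : 0 ≤ a) (ha1 : a ≤ 1) (x : Rn n) :
    |biharmonicKernel a x| ≤ 1 + (1 + ‖x‖ ^ 2) ^ 2 := by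
  have h0 : 0 ≤ shiftedNormSq a x := by unfold shiftedNormSq; positivity
  refine (abs_mul_log_le h0).trans ?_
  gcongr
  unfold shiftedNormSq
  gcongr

theorem polyBdd_one_add_sq : PolyBdd (fun x : Rn n => 1 + (1 + ‖x‖ ^ 2) ^ 2) := by
  have h := (polyBdd_const (n := n) 1).add (polyBdd_norm.mul polyBdd_norm)
  simpa [sq] using (polyBdd_const (n := n) 1).add (h.mul h)

theorem polyBdd_biharmonicKernel {a : ℝ} (ha : 0 ≤ a) (ha1 : a ≤ 1) :
    PolyBdd (biharmonicKernel (n := n) a) :=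
  polyBdd_one_add_sq.of_le fun x => by
    rw [Real.norm_eq_abs, Real.norm_of_nonneg (by positivity)]
    exact abs_biharmonicKernel_le ha ha1 x

theorem continuous_biharmonicKernel (a : ℝ) : Continuous (biharmonicKernel (n := n) a) :=
  Real.continuous_mul_log.comp (contDiff_shiftedNormSq a).continuous

/-- The normalization constant of the fundamental solution: the total mass of
`Δ² ((a + |x|²) log (a + |x|²)) = 32 a² / (a + |x|²)³`, which is independent of `a > 0`; it is
written here for `a = 1`. -/
noncomputable def biharmonicConst : ℝ := ∫ x : Rn 2, 32 * ((1 + ‖x‖ ^ 2) ^ 3)⁻¹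

theorem integrable_biharmonicMass : Integrable (fun x : Rn 2 => 32 * ((1 + ‖x‖ ^ 2) ^ 3)⁻¹) := by
  have h := integrable_rpow_neg_one_add_norm_sq (E := Rn 2) (μ := volume) (r := 6)
    (by simp; norm_num)
  refine (h.congr (Eventually.of_forall fun x => ?_)).const_mul 32
  simp only
  rw [← Real.rpow_natCast _ 3, ← Real.rpow_neg (by positivity)]
  norm_num

theorem biharmonicConst_pos : 0 < biharmonicConst := by
  refine (integral_pos_iff_support_of_nonneg (fun x => by positivity)
    integrable_biharmonicMass).2 ?_
  rw [show Function.support (fun x : Rn 2 => 32 * ((1 + ‖x‖ ^ 2) ^ 3)⁻¹) = Set.univ from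
    Set.eq_univ_of_forall fun x => by simp only [Function.mem_support]; positivity]
  simp

/-- `|x|² log |x|²` is, up to a constant, a fundamental solution of the squared Laplacian on the
plane: the functions `32 a² / (a + |x|²)³` form an approximate identity as `a = ε² → 0`. -/
theorem conv_biharmonicKernel_zero (φ : SchwartzMap (Rn 2) 𝕜) (x : Rn 2) :
    conv (biharmonicKernel 0) (schwartzLaplacian (schwartzLaplacian φ)) x =
      biharmonicConst • φ x := by
  set ψ := schwartzLaplacian (schwartzLaplacian φ) with hψ
  have hlim1 : Tendsto (fun ε : ℝ => conv (biharmonicKernel (ε ^ 2)) ψ x) (𝓝[>] 0)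
      (𝓝 (conv (biharmonicKernel 0) ψ x)) := by
    refine tendsto_integral_filter_of_dominated_convergence
      (fun y => ‖(1 + (1 + ‖y‖ ^ 2) ^ 2) • ψ (x - y)‖) (Eventually.of_forall fun ε => ?_) ?_
      (integrable_conv_integrand polyBdd_one_add_sq ?_ ψ x).norm
      (Eventually.of_forall fun y => ?_)
    · exact ((continuous_biharmonicKernel _).smul
        (ψ.continuous.comp (continuous_const.sub continuous_id))).aestronglyMeasurable
    · filter_upwards [Ioo_mem_nhdsGT (zero_lt_one (α := ℝ))] with ε hε
      refine Eventually.of_forall fun y => ?_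
      rw [norm_smul, norm_smul, Real.norm_eq_abs, Real.norm_of_nonneg (by positivity)]
      gcongr
      exact abs_biharmonicKernel_le (by positivity) (by nlinarith [hε.1, hε.2]) y
    · exact Continuous.aestronglyMeasurable (by fun_prop)
    · have hc : Continuous fun ε : ℝ => biharmonicKernel (ε ^ 2) y :=
        Real.continuous_mul_log.comp (by unfold shiftedNormSq; fun_prop)
      have := (hc.tendsto 0).mono_left (nhdsWithin_le_nhds (s := Set.Ioi 0))
      simp only [ne_eq, OfNat.ofNat_ne_zero, not_false_eq_true, zero_pow] at this
      exact this.smul_const _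
  have hscale : ∀ ε : ℝ, 0 < ε → conv (biharmonicKernel (ε ^ 2)) ψ x =
      ∫ z, (32 * ((1 + ‖z‖ ^ 2) ^ 3)⁻¹ : ℝ) • φ (x - ε • z) := by
    intro ε hε
    rw [hψ, conv_biharmonicKernel_bilaplacian (by positivity)]
    have := Measure.integral_comp_smul (volume : Measure (Rn 2)) (fun y =>
      (32 * (ε ^ 2) ^ 2 * ((shiftedNormSq (ε ^ 2) y) ^ 3)⁻¹) • φ (x - y)) ε
    rw [finrank_euclideanSpace_fin, abs_of_pos (by positivity)] at this
    have h2 : conv (fun y => 32 * (ε ^ 2) ^ 2 * ((shiftedNormSq (ε ^ 2) y) ^ 3)⁻¹) φ x =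
        ε ^ 2 • ∫ z, (32 * (ε ^ 2) ^ 2 * ((shiftedNormSq (ε ^ 2) (ε • z)) ^ 3)⁻¹) •
          φ (x - ε • z) := by
      rw [this, smul_smul, mul_inv_cancel₀ (by positivity), one_smul]
      rfl
    rw [h2, ← integral_smul]
    congr 1 with z
    rw [smul_smul]
    congr 1
    unfold shiftedNormSq
    rw [norm_smul, Real.norm_of_nonneg hε.le]
    have : ε ^ 2 + (ε * ‖z‖) ^ 2 = ε ^ 2 * (1 + ‖z‖ ^ 2) := by ring
    rw [this]
    field_simp
  have hlim2 : Tendsto (fun ε : ℝ => ∫ z, (32 * ((1 + ‖z‖ ^ 2) ^ 3)⁻¹ : ℝ) • φ (x - ε • z))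
      (𝓝[>] 0) (𝓝 (biharmonicConst • φ x)) := by
    unfold biharmonicConst
    rw [← integral_smul_const]
    obtain ⟨D, -, hD⟩ := schwartz_weighted_bound φ 0
    refine tendsto_integral_filter_of_dominated_convergence
      (fun z => ‖(32 * ((1 + ‖z‖ ^ 2) ^ 3)⁻¹ : ℝ)‖ * D) (Eventually.of_forall fun ε => ?_)
      (Eventually.of_forall fun ε => Eventually.of_forall fun z => ?_)
      (integrable_biharmonicMass.norm.mul_const D) (Eventually.of_forall fun z => ?_)
    · exact integrable_biharmonicMass.aestronglyMeasurable.smul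
        (φ.continuous.comp (by fun_prop)).aestronglyMeasurable
    · rw [norm_smul]
      gcongr
      simpa using hD (x - ε • z)
    · have hc : Continuous fun ε : ℝ => φ (x - ε • z) := φ.continuous.comp (by fun_prop)
      have := (hc.tendsto 0).mono_left (nhdsWithin_le_nhds (s := Set.Ioi 0))
      simp only [zero_smul, sub_zero] at this
      exact this.const_smul _
  refine tendsto_nhds_unique hlim1 (hlim2.congr' ?_)
  filter_upwards [self_mem_nhdsWithin] with ε hε using (hscale ε hε).symm

end Kernel
/-! ### Polynomial decay -/

section Decay
variable {n : ℕ}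

/-- The function is `O((1 + |x|)^{-m})`. -/
def DecayBdd {G : Type*} [NormedAddCommGroup G] (m : ℕ) (K : Rn n → G) : Prop :=
  ∃ C : ℝ, ∀ x, (1 + ‖x‖) ^ m * ‖K x‖ ≤ C

theorem DecayBdd.add {G : Type*} [NormedAddCommGroup G] {m : ℕ} {K L : Rn n → G}
    (hK : DecayBdd m K) (hL : DecayBdd m L) : DecayBdd m (fun x => K x + L x) := by
  obtain ⟨C, hC⟩ := hK
  obtain ⟨D, hD⟩ := hL
  refine ⟨C + D, fun x => ?_⟩
  calc (1 + ‖x‖) ^ m * ‖K x + L x‖ ≤ (1 + ‖x‖) ^ m * (‖K x‖ + ‖L x‖) := by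
        gcongr
        exact norm_add_le _ _
    _ ≤ C + D := by rw [mul_add]; exact add_le_add (hC x) (hD x)

theorem DecayBdd.neg {G : Type*} [NormedAddCommGroup G] {m : ℕ} {K : Rn n → G}
    (hK : DecayBdd m K) : DecayBdd m (fun x => -K x) := by
  simpa [DecayBdd] using hK

theorem DecayBdd.sum {G ι : Type*} [NormedAddCommGroup G] {m : ℕ} (s : Finset ι)
    {K : ι → Rn n → G} (hK : ∀ i, DecayBdd m (K i)) : DecayBdd m (fun x => ∑ i ∈ s, K i x) := by
  classical
  induction s using Finset.induction_on with
  | empty => exact ⟨0, fun x => by simp⟩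
  | insert a s ha ih => simpa [Finset.sum_insert ha] using (hK a).add ih

theorem DecayBdd.mono {G : Type*} [NormedAddCommGroup G] {m l : ℕ} (hml : m ≤ l) {K : Rn n → G}
    (hK : DecayBdd l K) : DecayBdd m K := by
  obtain ⟨C, hC⟩ := hK
  refine ⟨C, fun x => le_trans ?_ (hC x)⟩
  gcongr
  linarith [norm_nonneg x]

theorem DecayBdd.polyBdd {G : Type*} [NormedAddCommGroup G] {m : ℕ} {K : Rn n → G}
    (hK : DecayBdd m K) : PolyBdd K := by
  obtain ⟨C, hC⟩ := hK.mono (Nat.zero_le m)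
  exact ⟨C, 0, fun x => by simpa using hC x⟩

theorem DecayBdd.tendsto {G : Type*} [NormedAddCommGroup G] {m : ℕ} (hm : 1 ≤ m) {K : Rn n → G}
    (hK : DecayBdd m K) : Tendsto K (cocompact (Rn n)) (𝓝 0) := by
  obtain ⟨C, hC⟩ := hK.mono hm
  have h1 : Tendsto (fun x : Rn n => 1 + ‖x‖) (cocompact (Rn n)) atTop :=
    tendsto_atTop_add_const_left _ _ (tendsto_norm_cocompact_atTop (E := Rn n))
  refine squeeze_zero_norm (fun x => ?_) (tendsto_const_nhds.div_atTop h1 (a := C))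
  rw [le_div_iff₀ (by positivity)]
  simpa [mul_comm] using hC x

theorem DecayBdd.of_hasCompactSupport {G : Type*} [NormedAddCommGroup G] {K : Rn n → G}
    (hK : HasCompactSupport K) (hc : Continuous K) (m : ℕ) : DecayBdd m K := by
  have h1 : HasCompactSupport (fun x => (1 + ‖x‖) ^ m * ‖K x‖) := hK.norm.mul_left
  obtain ⟨C, hC⟩ := h1.exists_bound_of_continuous (by fun_prop)
  exact ⟨C, fun x => (le_abs_self _).trans (hC x)⟩

theorem DecayBdd.of_schwartz {F : Type*} [NormedAddCommGroup F] [NormedSpace ℝ F]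
    (φ : SchwartzMap (Rn n) F) (m : ℕ) : DecayBdd m φ := by
  obtain ⟨C, -, hC⟩ := schwartz_weighted_bound φ m
  exact ⟨C, hC⟩

theorem DecayBdd.of_norm_pow_mul_le {G : Type*} [NormedAddCommGroup G] {m : ℕ} {K : Rn n → G}
    (hc : Continuous K) {C : ℝ} (h : ∀ x, 2 < ‖x‖ → ‖x‖ ^ m * ‖K x‖ ≤ C) : DecayBdd m K := by
  obtain ⟨D, hD⟩ := (isCompact_closedBall (0 : Rn n) 2).exists_bound_of_continuousOn
    (f := fun x => (1 + ‖x‖) ^ m * ‖K x‖) (by fun_prop)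
  refine ⟨max D (2 ^ m * C), fun x => ?_⟩
  rcases le_or_gt ‖x‖ 2 with hx | hx
  · exact (le_abs_self _).trans ((hD x (by simpa using hx)).trans (le_max_left _ _))
  · refine le_trans ?_ (le_max_right _ _)
    calc (1 + ‖x‖) ^ m * ‖K x‖ ≤ (2 * ‖x‖) ^ m * ‖K x‖ := by gcongr; linarith
      _ = 2 ^ m * (‖x‖ ^ m * ‖K x‖) := by ring
      _ ≤ 2 ^ m * C := by gcongr; exact h x hx

variable {F : Type*} [NormedAddCommGroup F] [NormedSpace ℝ F]

theorem exists_schwartz_le_rpow (φ : SchwartzMap (Rn n) F) (m : ℕ) :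
    ∃ D, ∀ z, (1 + ‖z‖) ^ m * ‖φ z‖ ≤ D * (1 + ‖z‖) ^ (-(n + 1 : ℝ)) := by
  obtain ⟨D, -, hD⟩ := schwartz_weighted_bound φ (m + (n + 1))
  refine ⟨D, fun z => ?_⟩
  have hp : (1 + ‖z‖) ^ (-(n + 1 : ℝ)) = ((1 + ‖z‖) ^ (n + 1))⁻¹ := by
    rw [Real.rpow_neg (by positivity)]
    norm_cast
  rw [hp, ← div_eq_mul_inv, le_div_iff₀ (by positivity)]
  calc _ = (1 + ‖z‖) ^ (m + (n + 1)) * ‖φ z‖ := by ring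
    _ ≤ D := hD z

/-- Convolution with a Schwartz function preserves polynomial decay. -/
theorem DecayBdd.conv {m : ℕ} {K : Rn n → ℝ} (hK : DecayBdd m K) (φ : SchwartzMap (Rn n) F) :
    DecayBdd m (conv K φ) := by
  obtain ⟨C, hC⟩ := hK
  obtain ⟨D, hD⟩ := exists_schwartz_le_rpow φ m
  have hC0 : 0 ≤ C := le_trans (by positivity) (hC 0)
  have hint := (integrable_one_add_norm_rpow_neg (n := n)).const_mul (C * D)
  refine ⟨∫ z : Rn n, C * D * (1 + ‖z‖) ^ (-(n + 1 : ℝ)), fun x => ?_⟩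
  rw [← integral_sub_left_eq_self _ volume x]
  have h0 : ‖(1 + ‖x‖) ^ m • TensorDecomp.conv K φ x‖ =
      (1 + ‖x‖) ^ m * ‖TensorDecomp.conv K φ x‖ := by
    rw [norm_smul, Real.norm_of_nonneg (by positivity)]
  rw [← h0, TensorDecomp.conv, ← integral_smul]
  refine norm_integral_le_of_norm_le (hint.comp_sub_left x) (Eventually.of_forall fun y => ?_)
  rw [norm_smul, norm_smul, Real.norm_of_nonneg (by positivity)]
  calc (1 + ‖x‖) ^ m * (‖K y‖ * ‖φ (x - y)‖)
      ≤ ((1 + ‖y‖) ^ m * (1 + ‖x - y‖) ^ m) * (‖K y‖ * ‖φ (x - y)‖) := by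
        gcongr
        exact one_add_norm_pow_le x y m
    _ = ((1 + ‖y‖) ^ m * ‖K y‖) * ((1 + ‖x - y‖) ^ m * ‖φ (x - y)‖) := by ring
    _ ≤ C * (D * (1 + ‖x - y‖) ^ (-(n + 1 : ℝ))) :=
        mul_le_mul (hC y) (hD _) (by positivity) hC0
    _ = _ := by ring

/-- Against a Schwartz function of mean zero, convolution gains one order of decay: it is
controlled by the first derivatives of the kernel. -/
theorem decayBdd_conv_of_integral_eq_zero {K : Rn n → ℝ} (hs : ContDiff ℝ ∞ K)
    (hK : ∀ i, DecayBdd 1 (partialDeriv i K)) (φ : SchwartzMap (Rn n) F) (hφ : ∫ x, φ x = 0) :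
    DecayBdd 1 (conv K φ) := by
  have hKp : PolyBdd K := PolyBdd.of_partialDeriv (hs.differentiable (by simp))
    fun i => (hK i).polyBdd
  obtain ⟨C, hC⟩ : ∃ C, ∀ w, (1 + ‖w‖) * ‖fderiv ℝ K w‖ ≤ C := by
    have h1 : ∀ i, DecayBdd 1 (fun x => ‖partialDeriv i K x‖) := fun i => by
      simpa [DecayBdd] using hK i
    obtain ⟨C, hC⟩ := DecayBdd.sum Finset.univ h1
    refine ⟨C, fun w => le_trans ?_ (hC w)⟩
    rw [pow_one]
    gcongr
    exact (norm_fderiv_le_sum_partialDeriv K w).trans (le_abs_self _)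
  have hC0 : 0 ≤ C := le_trans (by positivity) (hC 0)
  obtain ⟨D, hD⟩ := exists_schwartz_le_rpow φ 2
  -- the mean value inequality on the ball of radius `|z|` around `x`
  have hmv : ∀ x z : Rn n, (1 + ‖x‖) * ‖K (x - z) - K x‖ ≤ C * (1 + ‖z‖) ^ 2 := by
    intro x z
    have h1 := (convex_closedBall x ‖z‖).norm_image_sub_le_of_norm_fderiv_le (𝕜 := ℝ)
      (f := K) (C := C * (1 + ‖z‖) / (1 + ‖x‖)) (x := x) (y := x - z)
      (fun y _ => hs.differentiable (by simp) y) (fun w hw => ?_) (by simp) (by simp)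
    · rw [show x - z - x = -z by abel, norm_neg, div_mul_eq_mul_div,
        le_div_iff₀ (by positivity)] at h1
      have : C * (1 + ‖z‖) * ‖z‖ ≤ C * (1 + ‖z‖) * (1 + ‖z‖) := by gcongr; linarith
      nlinarith
    · rw [le_div_iff₀ (by positivity)]
      have h2 := one_add_norm_pow_le x w 1
      have h3 : ‖x - w‖ ≤ ‖z‖ := by rwa [norm_sub_rev, ← mem_closedBall_iff_norm]
      simp only [pow_one] at h2
      calc ‖fderiv ℝ K w‖ * (1 + ‖x‖)
          ≤ ‖fderiv ℝ K w‖ * ((1 + ‖w‖) * (1 + ‖z‖)) := by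
            gcongr
            exact h2.trans (by gcongr)
        _ = ((1 + ‖w‖) * ‖fderiv ℝ K w‖) * (1 + ‖z‖) := by ring
        _ ≤ C * (1 + ‖z‖) := by gcongr; exact hC w
  have hint := (integrable_one_add_norm_rpow_neg (n := n)).const_mul (C * D)
  refine ⟨∫ z : Rn n, C * D * (1 + ‖z‖) ^ (-(n + 1 : ℝ)), fun x => ?_⟩
  have e1 : conv K φ x = ∫ z, K (x - z) • φ z := by
    rw [← integral_sub_left_eq_self (fun z => K (x - z) • φ z) volume x]
    simp [conv]
  have hi1 : Integrable (fun z => K (x - z) • φ z) := by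
    simpa using
      (integrable_conv_integrand hKp hs.continuous.aestronglyMeasurable φ x).comp_sub_left x
  have e2 : conv K φ x = ∫ z, (K (x - z) - K x) • φ z := by
    simp_rw [sub_smul]
    have hi2 : Integrable (fun z => K x • φ z) := φ.integrable.smul (K x)
    rw [integral_sub hi1 hi2, integral_smul, hφ, smul_zero, sub_zero, e1]
  have h0 : ‖(1 + ‖x‖) • conv K φ x‖ = (1 + ‖x‖) ^ 1 * ‖conv K φ x‖ := by
    rw [norm_smul, Real.norm_of_nonneg (by positivity), pow_one]
  rw [← h0, e2, ← integral_smul]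
  refine norm_integral_le_of_norm_le hint (Eventually.of_forall fun z => ?_)
  rw [norm_smul, norm_smul, Real.norm_of_nonneg (by positivity)]
  calc (1 + ‖x‖) * (‖K (x - z) - K x‖ * ‖φ z‖)
      = ((1 + ‖x‖) * ‖K (x - z) - K x‖) * ‖φ z‖ := by ring
    _ ≤ (C * (1 + ‖z‖) ^ 2) * ‖φ z‖ := mul_le_mul_of_nonneg_right (hmv x z) (norm_nonneg _)
    _ = C * ((1 + ‖z‖) ^ 2 * ‖φ z‖) := by ring
    _ ≤ C * (D * (1 + ‖z‖) ^ (-(n + 1 : ℝ))) := mul_le_mul_of_nonneg_left (hD z) hC0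
    _ = _ := by ring

end Decay

/-! ### Homogeneity of the derivatives of the kernel -/

section Homogeneous
variable {n : ℕ}

theorem contDiffOn_partialDeriv {K : Rn n → ℝ} {s : Set (Rn n)} (hs : IsOpen s)
    (hK : ContDiffOn ℝ ∞ K s) (i : Fin n) : ContDiffOn ℝ ∞ (partialDeriv i K) s :=
  (hK.fderiv_of_isOpen (m := ∞) hs (by simp)).clm_apply contDiffOn_const

/-- If `K` is homogeneous of degree `-m` away from the origin, up to additive constants depending on
the dilation, then its derivatives are homogeneous of degree `-(m + 1)`. -/
theorem homogeneous_partialDeriv {K : Rn n → ℝ} (hK : ContDiffOn ℝ ∞ K {0}ᶜ) {m : ℕ} {c : ℝ → ℝ}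
    (hh : ∀ t : ℝ, 0 < t → ∀ x : Rn n, x ≠ 0 → t ^ m * K (t • x) = K x + c t) (i : Fin n)
    (t : ℝ) (ht : 0 < t) (x : Rn n) (hx : x ≠ 0) :
    t ^ (m + 1) * partialDeriv i K (t • x) = partialDeriv i K x := by
  have hd : ∀ y : Rn n, y ≠ 0 → DifferentiableAt ℝ K y := fun y hy =>
    (hK.contDiffAt (isOpen_compl_singleton.mem_nhds hy)).differentiableAt (by simp)
  have hne : t • x ≠ 0 := smul_ne_zero ht.ne' hx
  have e : (fun y => t ^ m * K (t • y)) =ᶠ[𝓝 x] fun y => K y + c t := by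
    filter_upwards [isOpen_compl_singleton.mem_nhds hx] with y hy
    exact hh t ht y hy
  have h1 := (partialDeriv_congr_of_eventuallyEq e i).eq_of_nhds
  have hd2 : DifferentiableAt ℝ (fun y => K (t • y)) x :=
    (hd _ hne).comp x (differentiableAt_id.const_smul t)
  rw [partialDeriv_mul (differentiableAt_const _) hd2, partialDeriv_comp_smul] at h1
  have h2 : partialDeriv i (fun _ : Rn n => t ^ m) x = 0 := by simp [partialDeriv]
  have h3 : partialDeriv i (fun y => K y + c t) x = partialDeriv i K x := by
    simp [partialDeriv]
  rw [h2, h3] at h1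
  rw [← h1]
  simp only [smul_eq_mul]
  ring

/-- A continuous function on the punctured space that is homogeneous of degree `-m` is
`O(|x|^{-m})`, by compactness of the unit sphere. -/
theorem exists_bound_of_homogeneous {K : Rn n → ℝ} (hK : ContinuousOn K {0}ᶜ) {m : ℕ}
    (hh : ∀ t : ℝ, 0 < t → ∀ x : Rn n, x ≠ 0 → t ^ m * K (t • x) = K x) :
    ∃ C, ∀ x, x ≠ 0 → ‖x‖ ^ m * ‖K x‖ ≤ C := by
  obtain ⟨C, hC⟩ := (isCompact_sphere (0 : Rn n) 1).exists_bound_of_continuousOn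
    (hK.mono fun x hx => by
      simp only [Set.mem_compl_iff, Set.mem_singleton_iff]
      rintro rfl
      simp at hx)
  refine ⟨C, fun x hx => ?_⟩
  have hp : 0 < ‖x‖ := norm_pos_iff.2 hx
  have h1 := hh ‖x‖ hp (‖x‖⁻¹ • x) (smul_ne_zero (inv_ne_zero hp.ne') hx)
  rw [smul_smul, mul_inv_cancel₀ hp.ne', one_smul] at h1
  have h2 := hC (‖x‖⁻¹ • x) (by simp [norm_smul, hp.ne'])
  rw [← h1, norm_mul, norm_pow, norm_norm] at h2
  exact h2

theorem shiftedNormSq_zero_ne {x : Rn n} (hx : x ≠ 0) : shiftedNormSq 0 x ≠ 0 := by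
  simpa [shiftedNormSq] using hx

theorem contDiffOn_biharmonicKernel_zero :
    ContDiffOn ℝ ∞ (biharmonicKernel (n := n) 0) {0}ᶜ :=
  (contDiff_shiftedNormSq 0).contDiffOn.mul
    ((contDiff_shiftedNormSq 0).contDiffOn.log fun _ hx => shiftedNormSq_zero_ne hx)

/-- The second derivatives of `|x|² log |x|²` are homogeneous of degree zero up to an additive
constant. -/
theorem partialDeriv_two_biharmonicKernel_smul (i j : Fin n) {t : ℝ} (ht : 0 < t) {x : Rn n}
    (hx : x ≠ 0) :
    partialDeriv i (partialDeriv j (biharmonicKernel 0)) (t • x) =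
      partialDeriv i (partialDeriv j (biharmonicKernel 0)) x +
        (if i = j then 2 else 0) * Real.log (t ^ 2) := by
  have hq : shiftedNormSq 0 (t • x) = t ^ 2 * shiftedNormSq 0 x := by
    simp [shiftedNormSq, norm_smul, mul_pow]
  have hne := shiftedNormSq_zero_ne hx
  rw [partialDeriv_partialDeriv_biharmonicKernel hne,
    partialDeriv_partialDeriv_biharmonicKernel (shiftedNormSq_zero_ne (smul_ne_zero ht.ne' hx)),
    hq, Real.log_mul (by positivity) hne]
  simp only [PiLp.smul_apply, smul_eq_mul]
  field_simp
  ring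

theorem homogeneous_partialDeriv_three (i j k : Fin n) (t : ℝ) (ht : 0 < t) (x : Rn n)
    (hx : x ≠ 0) :
    t ^ 1 * partialDeriv i (partialDeriv j (partialDeriv k (biharmonicKernel 0))) (t • x) =
      partialDeriv i (partialDeriv j (partialDeriv k (biharmonicKernel 0))) x := by
  refine homogeneous_partialDeriv (m := 0)
    (c := fun t => (if j = k then 2 else 0) * Real.log (t ^ 2))
    (contDiffOn_partialDeriv isOpen_compl_singleton (contDiffOn_partialDeriv
      isOpen_compl_singleton contDiffOn_biharmonicKernel_zero k) j)
    (fun t ht x hx => ?_) i t ht x hx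
  rw [pow_zero, one_mul, partialDeriv_two_biharmonicKernel_smul j k ht hx]

theorem homogeneous_partialDeriv_four (i j k l : Fin n) (t : ℝ) (ht : 0 < t) (x : Rn n)
    (hx : x ≠ 0) :
    t ^ 2 * partialDeriv i (partialDeriv j (partialDeriv k (partialDeriv l
      (biharmonicKernel 0)))) (t • x) =
      partialDeriv i (partialDeriv j (partialDeriv k (partialDeriv l (biharmonicKernel 0)))) x :=
  homogeneous_partialDeriv (m := 1) (c := 0)
    (contDiffOn_partialDeriv isOpen_compl_singleton (contDiffOn_partialDeriv isOpen_compl_singleton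
      (contDiffOn_partialDeriv isOpen_compl_singleton contDiffOn_biharmonicKernel_zero l) k) j)
    (fun t ht x hx => by rw [homogeneous_partialDeriv_three j k l t ht x hx]; simp) i t ht x hx

end Homogeneous

/-! ### Decay of convolutions with derivatives of the kernel -/

section Cutoff
variable {n : ℕ}

/-- A smooth cutoff, equal to one on the unit ball and supported in the ball of radius two. -/
noncomputable def cutoff (n : ℕ) : ContDiffBump (0 : Rn n) := ⟨1, 2, one_pos, one_lt_two⟩

/-- The part of the kernel `|x|² log |x|²` near the origin. -/
noncomputable def nearKernel (x : Rn n) : ℝ := cutoff n x * biharmonicKernel 0 x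

/-- The part of the kernel `|x|² log |x|²` away from the origin. -/
noncomputable def farKernel (x : Rn n) : ℝ := (1 - cutoff n x) * biharmonicKernel 0 x

theorem nearKernel_add_farKernel :
    (fun x : Rn n => nearKernel x + farKernel x) = biharmonicKernel 0 := by
  ext x
  simp only [nearKernel, farKernel]
  ring

theorem continuous_nearKernel : Continuous (nearKernel (n := n)) :=
  (cutoff n).continuous.mul (continuous_biharmonicKernel 0)

theorem decayBdd_nearKernel (m : ℕ) : DecayBdd m (nearKernel (n := n)) :=
  .of_hasCompactSupport (cutoff n).hasCompactSupport.mul_right continuous_nearKernel m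

theorem contDiff_farKernel : ContDiff ℝ ∞ (farKernel (n := n)) := by
  rw [contDiff_iff_contDiffAt]
  intro x
  by_cases hx : x = 0
  · subst hx
    have e : farKernel =ᶠ[𝓝 (0 : Rn n)] fun _ => 0 := by
      filter_upwards [(cutoff n).eventuallyEq_one] with y hy
      simp [farKernel, hy]
    exact contDiffAt_const.congr_of_eventuallyEq e
  · exact (contDiffAt_const.sub (cutoff n).contDiffAt).mul
      (contDiffOn_biharmonicKernel_zero.contDiffAt (isOpen_compl_singleton.mem_nhds hx))

theorem farKernel_eventuallyEq {x : Rn n} (hx : 2 < ‖x‖) :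
    farKernel =ᶠ[𝓝 x] biharmonicKernel 0 := by
  filter_upwards [(isOpen_lt continuous_const continuous_norm).mem_nhds hx] with y hy
  have : cutoff n y = 0 := (cutoff n).zero_of_le_dist (by
    simpa [cutoff] using (le_of_lt hy : (2 : ℝ) ≤ ‖y‖))
  simp [farKernel, this]

theorem decayBdd_partialDeriv_three_farKernel (i j k : Fin n) :
    DecayBdd 1 (partialDeriv i (partialDeriv j (partialDeriv k farKernel))) := by
  have ho := isOpen_compl_singleton (x := (0 : Rn n))
  obtain ⟨C, hC⟩ := exists_bound_of_homogeneous
    (contDiffOn_partialDeriv ho (contDiffOn_partialDeriv ho (contDiffOn_partialDeriv ho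
      contDiffOn_biharmonicKernel_zero k) j) i).continuousOn
    (homogeneous_partialDeriv_three i j k)
  refine .of_norm_pow_mul_le (contDiff_partialDeriv (contDiff_partialDeriv
    (contDiff_partialDeriv contDiff_farKernel k) j) i).continuous (C := C) fun x hx => ?_
  rw [(partialDeriv_congr_of_eventuallyEq (partialDeriv_congr_of_eventuallyEq
    (partialDeriv_congr_of_eventuallyEq (farKernel_eventuallyEq hx) k) j) i).eq_of_nhds]
  exact hC x (norm_pos_iff.1 (by linarith))

theorem decayBdd_partialDeriv_four_farKernel (i j k l : Fin n) :
    DecayBdd 2 (partialDeriv i (partialDeriv j (partialDeriv k (partialDeriv l farKernel)))) := by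
  have ho := isOpen_compl_singleton (x := (0 : Rn n))
  obtain ⟨C, hC⟩ := exists_bound_of_homogeneous
    (contDiffOn_partialDeriv ho (contDiffOn_partialDeriv ho (contDiffOn_partialDeriv ho
      (contDiffOn_partialDeriv ho contDiffOn_biharmonicKernel_zero l) k) j) i).continuousOn
    (homogeneous_partialDeriv_four i j k l)
  refine .of_norm_pow_mul_le (contDiff_partialDeriv (contDiff_partialDeriv (contDiff_partialDeriv
    (contDiff_partialDeriv contDiff_farKernel l) k) j) i).continuous (C := C) fun x hx => ?_
  rw [(partialDeriv_congr_of_eventuallyEq (partialDeriv_congr_of_eventuallyEq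
    (partialDeriv_congr_of_eventuallyEq (partialDeriv_congr_of_eventuallyEq
      (farKernel_eventuallyEq hx) l) k) j) i).eq_of_nhds]
  exact hC x (norm_pos_iff.1 (by linarith))

theorem polyBdd_partialDeriv_two_farKernel (i j : Fin n) :
    PolyBdd (partialDeriv i (partialDeriv j farKernel)) :=
  PolyBdd.of_partialDeriv ((contDiff_partialDeriv (contDiff_partialDeriv contDiff_farKernel j)
    i).differentiable (by simp)) fun k => (decayBdd_partialDeriv_three_farKernel k i j).polyBdd

theorem polyBdd_partialDeriv_farKernel (i : Fin n) : PolyBdd (partialDeriv i farKernel) :=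
  PolyBdd.of_partialDeriv ((contDiff_partialDeriv contDiff_farKernel i).differentiable (by simp))
    fun j => polyBdd_partialDeriv_two_farKernel j i

theorem polyBdd_farKernel : PolyBdd (farKernel (n := n)) :=
  PolyBdd.of_partialDeriv (contDiff_farKernel.differentiable (by simp))
    polyBdd_partialDeriv_farKernel

variable {𝕜 : Type*} [RCLike 𝕜]

theorem conv_partialDeriv_of_contDiff {K : Rn n → ℝ} (hs : ContDiff ℝ ∞ K) (hK : PolyBdd K)
    {i : Fin n} (hK' : PolyBdd (partialDeriv i K)) (φ : SchwartzMap (Rn n) 𝕜) :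
    conv K (schwartzPartial i φ) = conv (partialDeriv i K) φ :=
  conv_schwartzPartial hK (hs.differentiable (by simp)) hK'
    (contDiff_partialDeriv hs i).continuous.aestronglyMeasurable φ

theorem conv_biharmonicKernel_eq (φ : SchwartzMap (Rn n) 𝕜) :
    conv (biharmonicKernel 0) φ = fun x => conv nearKernel φ x + conv farKernel φ x := by
  ext x
  rw [← conv_add_left (decayBdd_nearKernel 0).polyBdd
    continuous_nearKernel.aestronglyMeasurable polyBdd_farKernel
    contDiff_farKernel.continuous.aestronglyMeasurable, nearKernel_add_farKernel]

theorem conv_farKernel_two (i j : Fin n) (φ : SchwartzMap (Rn n) 𝕜) :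
    conv farKernel (schwartzPartial i (schwartzPartial j φ)) =
      conv (partialDeriv j (partialDeriv i farKernel)) φ := by
  rw [conv_partialDeriv_of_contDiff contDiff_farKernel polyBdd_farKernel
    (polyBdd_partialDeriv_farKernel i), conv_partialDeriv_of_contDiff
    (contDiff_partialDeriv contDiff_farKernel i) (polyBdd_partialDeriv_farKernel i)
    (polyBdd_partialDeriv_two_farKernel j i)]

theorem conv_farKernel_three (i j k : Fin n) (φ : SchwartzMap (Rn n) 𝕜) :
    conv farKernel (schwartzPartial i (schwartzPartial j (schwartzPartial k φ))) =
      conv (partialDeriv k (partialDeriv j (partialDeriv i farKernel))) φ := by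
  rw [conv_farKernel_two, conv_partialDeriv_of_contDiff
    (contDiff_partialDeriv (contDiff_partialDeriv contDiff_farKernel i) j)
    (polyBdd_partialDeriv_two_farKernel j i) (decayBdd_partialDeriv_three_farKernel k j i).polyBdd]

theorem conv_farKernel_four (i j k l : Fin n) (φ : SchwartzMap (Rn n) 𝕜) :
    conv farKernel (schwartzPartial i (schwartzPartial j (schwartzPartial k
      (schwartzPartial l φ)))) =
      conv (partialDeriv l (partialDeriv k (partialDeriv j (partialDeriv i farKernel)))) φ := by
  rw [conv_farKernel_three, conv_partialDeriv_of_contDiff (contDiff_partialDeriv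
    (contDiff_partialDeriv (contDiff_partialDeriv contDiff_farKernel i) j) k)
    (decayBdd_partialDeriv_three_farKernel k j i).polyBdd
    (decayBdd_partialDeriv_four_farKernel l k j i).polyBdd]

/-- The second derivatives of the kernel grow logarithmically; the mean zero condition makes the
convolution decay nevertheless. -/
theorem decayBdd_conv_two (i j : Fin n) (φ : SchwartzMap (Rn n) 𝕜) (hφ : ∫ x, φ x = 0) :
    DecayBdd 1 (conv (biharmonicKernel 0) (schwartzPartial i (schwartzPartial j φ))) := by
  rw [conv_biharmonicKernel_eq, conv_farKernel_two]
  exact ((decayBdd_nearKernel 1).conv _).add (decayBdd_conv_of_integral_eq_zero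
    (contDiff_partialDeriv (contDiff_partialDeriv contDiff_farKernel i) j)
    (fun k => decayBdd_partialDeriv_three_farKernel k j i) φ hφ)

theorem decayBdd_conv_three (i j k : Fin n) (φ : SchwartzMap (Rn n) 𝕜) :
    DecayBdd 1 (conv (biharmonicKernel 0)
      (schwartzPartial i (schwartzPartial j (schwartzPartial k φ)))) := by
  rw [conv_biharmonicKernel_eq, conv_farKernel_three]
  exact ((decayBdd_nearKernel 1).conv _).add ((decayBdd_partialDeriv_three_farKernel k j i).conv _)

theorem decayBdd_conv_four (i j k l : Fin n) (φ : SchwartzMap (Rn n) 𝕜) :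
    DecayBdd 2 (conv (biharmonicKernel 0)
      (schwartzPartial i (schwartzPartial j (schwartzPartial k (schwartzPartial l φ))))) := by
  rw [conv_biharmonicKernel_eq, conv_farKernel_four]
  exact ((decayBdd_nearKernel 2).conv _).add ((decayBdd_partialDeriv_four_farKernel l k j i).conv _)

end Cutoff
/-! ### Existence -/

section Existence
variable {𝕜 : Type*} [RCLike 𝕜]

theorem exists_tensorNorm_le {n r : ℕ} {T : TensorField 𝕜 n r} {m : ℕ}
    (hT : ∀ I, DecayBdd m (fun x => T x I)) :
    ∃ C : ℝ, ∀ x, tensorNorm (T x) ≤ C * (1 + ‖x‖) ^ (-(m : ℤ)) := by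
  obtain ⟨C, hC⟩ := DecayBdd.sum Finset.univ fun I =>
    (show DecayBdd m (fun x => ‖T x I‖) by simpa [DecayBdd] using hT I)
  refine ⟨C, fun x => ?_⟩
  rw [zpow_neg, zpow_natCast, ← div_eq_mul_inv, le_div_iff₀ (by positivity), mul_comm]
  refine le_trans ?_ (hC x)
  gcongr
  rw [Real.norm_of_nonneg (by positivity)]
  exact Real.sqrt_le_iff.2 ⟨by positivity,
    Finset.sum_sq_le_sq_sum_of_nonneg fun _ _ => norm_nonneg _⟩

/-- The double divergence of a matrix of Schwartz functions. -/
noncomputable def schwartzDivDiv {n : ℕ} (F : Fin n → Fin n → SchwartzMap (Rn n) 𝕜) :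
    SchwartzMap (Rn n) 𝕜 :=
  ∑ j, ∑ k, schwartzPartial j (schwartzPartial k (F j k))

theorem schwartzPartial_schwartzDivDiv {n : ℕ} (F : Fin n → Fin n → SchwartzMap (Rn n) 𝕜)
    (i : Fin n) :
    schwartzPartial i (schwartzDivDiv F) =
      ∑ j, ∑ k, schwartzPartial i (schwartzPartial j (schwartzPartial k (F j k))) := by
  simp only [schwartzDivDiv, schwartzPartial_sum]

/-- The potential of a matrix `F` of Schwartz functions: `|x|² log |x|²` convolved with the double
divergence of `F`. -/
noncomputable def potential (F : Fin 2 → Fin 2 → SchwartzMap (Rn 2) 𝕜) : Rn 2 → 𝕜 :=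
  conv (biharmonicKernel 0) (schwartzDivDiv F)

theorem conv_biharmonicKernel_sum_sum (G : Fin 2 → Fin 2 → SchwartzMap (Rn 2) 𝕜) :
    conv (biharmonicKernel 0) (∑ j, ∑ k, G j k : SchwartzMap (Rn 2) 𝕜) =
      fun x => ∑ j, ∑ k, conv (biharmonicKernel 0) (G j k) x := by
  have hp := polyBdd_biharmonicKernel (n := 2) le_rfl zero_le_one
  have hm := (continuous_biharmonicKernel (n := 2) 0).aestronglyMeasurable (μ := volume)
  ext x
  rw [conv_sum _ hp hm]
  exact Finset.sum_congr rfl fun j _ => conv_sum _ hp hm _ x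

theorem contDiff_conv_biharmonicKernel (φ : SchwartzMap (Rn 2) 𝕜) :
    ContDiff ℝ ∞ (conv (biharmonicKernel 0) φ) :=
  contDiff_conv (polyBdd_biharmonicKernel le_rfl zero_le_one)
    (continuous_biharmonicKernel 0).aestronglyMeasurable φ

theorem partialDeriv_conv_biharmonicKernel (φ : SchwartzMap (Rn 2) 𝕜) (i : Fin 2) :
    partialDeriv i (conv (biharmonicKernel 0) φ) =
      conv (biharmonicKernel 0) (schwartzPartial i φ) :=
  partialDeriv_conv (polyBdd_biharmonicKernel le_rfl zero_le_one)
    (continuous_biharmonicKernel 0).aestronglyMeasurable φ i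

theorem decayBdd_potential (F : Fin 2 → Fin 2 → SchwartzMap (Rn 2) 𝕜)
    (hF : ∀ j k, ∫ x, F j k x = 0) : DecayBdd 1 (potential F) := by
  unfold potential schwartzDivDiv
  rw [conv_biharmonicKernel_sum_sum]
  exact DecayBdd.sum _ fun j => DecayBdd.sum _ fun k => decayBdd_conv_two j k _ (hF j k)

theorem decayBdd_partialDeriv_potential (F : Fin 2 → Fin 2 → SchwartzMap (Rn 2) 𝕜) (i : Fin 2) :
    DecayBdd 1 (partialDeriv i (potential F)) := by
  unfold potential
  rw [partialDeriv_conv_biharmonicKernel, schwartzPartial_schwartzDivDiv,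
    conv_biharmonicKernel_sum_sum]
  exact DecayBdd.sum _ fun j => DecayBdd.sum _ fun k => decayBdd_conv_three i j k _

theorem decayBdd_partialDeriv_two_potential (F : Fin 2 → Fin 2 → SchwartzMap (Rn 2) 𝕜)
    (i j : Fin 2) : DecayBdd 2 (partialDeriv i (partialDeriv j (potential F))) := by
  unfold potential
  simp only [partialDeriv_conv_biharmonicKernel, schwartzPartial_schwartzDivDiv,
    schwartzPartial_sum]
  rw [conv_biharmonicKernel_sum_sum]
  exact DecayBdd.sum _ fun k => DecayBdd.sum _ fun l => decayBdd_conv_four i j k l _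

theorem bilaplacian_potential (F : Fin 2 → Fin 2 → SchwartzMap (Rn 2) 𝕜) (x : Rn 2) :
    ∑ j, ∑ k, partialDeriv j (partialDeriv k (partialDeriv j (partialDeriv k (potential F)))) x =
      biharmonicConst • schwartzDivDiv F x := by
  unfold potential
  simp only [partialDeriv_conv_biharmonicKernel]
  rw [← conv_biharmonicKernel_zero]
  have := congrFun (conv_biharmonicKernel_sum_sum fun j k => schwartzPartial j
    (schwartzPartial k (schwartzPartial j (schwartzPartial k (schwartzDivDiv F))))) x
  rw [← this]
  refine congrArg (fun ψ : SchwartzMap (Rn 2) 𝕜 => conv (biharmonicKernel 0) ψ x) ?_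
  unfold schwartzLaplacian
  simp only [schwartzPartial_sum]
  refine Finset.sum_congr rfl fun j _ => Finset.sum_congr rfl fun k _ => ?_
  rw [schwartzPartial_comm k j]

/-- A symmetric Schwartz field whose components have mean zero admits a decaying decomposition,
with decay rates. -/
theorem exists_isDecayingDecomposition (f : (Fin 2 → Fin 2) → SchwartzMap (Rn 2) 𝕜)
    (hf : IsSymmetric (ofSchwartz f)) (h0 : ∀ I, ∫ x, f I x = 0) :
    ∃ (g : TensorField 𝕜 2 2) (v : Rn 2 → 𝕜), IsDecayingDecomposition (ofSchwartz f) g v ∧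
      (∀ I, DecayBdd 2 (fun x => g x I)) ∧ DecayBdd 1 v ∧ ∀ i, DecayBdd 1 (partialDeriv i v) := by
  -- rescaled so that `Δ² (potential F)` is the double divergence of `f`
  set F : Fin 2 → Fin 2 → SchwartzMap (Rn 2) 𝕜 := fun j k => biharmonicConst⁻¹ • f ![j, k] with hF
  set v := potential F with hv
  have hvs : ContDiff ℝ ∞ v := contDiff_conv_biharmonicKernel _
  have hF0 : ∀ j k, ∫ x, F j k x = 0 := fun j k => by
    simp [hF, integral_smul, h0]
  have hcomp : ∀ I, (fun x => (ofSchwartz f - innerDPow 2 v) x I) =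
      fun x => f I x - partialDeriv (I 0) (partialDeriv (I 1) v) x := fun I => funext fun x => by
    rw [← innerDPow_two_apply hvs]
    rfl
  have hdec : ∀ I, DecayBdd 2 (fun x => (ofSchwartz f - innerDPow 2 v) x I) := fun I => by
    rw [hcomp]
    simp_rw [sub_eq_add_neg]
    exact (DecayBdd.of_schwartz (f I) 2).add
      (decayBdd_partialDeriv_two_potential F (I 0) (I 1)).neg
  have hv2 : ∀ i j, ContDiff ℝ ∞ (partialDeriv i (partialDeriv j v)) := fun i j =>
    contDiff_partialDeriv (contDiff_partialDeriv hvs j) i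
  refine ⟨ofSchwartz f - innerDPow 2 v, v, ⟨?_, ?_, hvs, by simp, ?_, ?_, ?_⟩, hdec,
    decayBdd_potential F hF0, decayBdd_partialDeriv_potential F⟩
  · refine contDiff_pi.2 fun I => ?_
    rw [hcomp]
    exact ((f I).smooth _).sub (hv2 _ _)
  · intro x π I
    have e := hf x π I
    simp only [Pi.sub_apply, e]
    congr 1
    rw [innerDPow_two_apply hvs, innerDPow_two_apply hvs]
    have hπ : π = 1 ∨ π = Equiv.swap 0 1 := by
      clear e
      revert π
      decide
    rcases hπ with rfl | rfl
    · rfl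
    · simp only [Function.comp_apply, Equiv.swap_apply_left, Equiv.swap_apply_right]
      rw [partialDeriv_comm hvs]
  · ext x I
    rw [divergence_divergence_apply]
    simp only [hcomp, Matrix.cons_val_zero, Matrix.cons_val_one]
    have e1 : ∀ j k : Fin 2, partialDeriv k
        (fun z => f ![j, k] z - partialDeriv j (partialDeriv k v) z) =
        fun z => partialDeriv k (f ![j, k]) z -
          partialDeriv k (partialDeriv j (partialDeriv k v)) z :=
      fun j k => partialDeriv_sub ((f _).smooth _) (hv2 j k) k
    have hs1 : ∀ j k : Fin 2, ContDiff ℝ ∞ (partialDeriv k (f ![j, k])) := fun j k =>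
      contDiff_partialDeriv ((f _).smooth _) k
    have hs3 : ∀ j k : Fin 2, ContDiff ℝ ∞ (partialDeriv k (partialDeriv j (partialDeriv k v))) :=
      fun j k => contDiff_partialDeriv (hv2 j k) k
    simp only [e1]
    have e2 : ∀ j : Fin 2, partialDeriv j (fun y => ∑ k, (partialDeriv k (f ![j, k]) y -
        partialDeriv k (partialDeriv j (partialDeriv k v)) y)) x =
        ∑ k, partialDeriv j (partialDeriv k (f ![j, k])) x -
        ∑ k, partialDeriv j (partialDeriv k (partialDeriv j (partialDeriv k v))) x := by
      intro j
      rw [partialDeriv_sum _ fun k => (hs1 j k).sub (hs3 j k), ← Finset.sum_sub_distrib]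
      exact Finset.sum_congr rfl fun k _ => congrFun (partialDeriv_sub (hs1 j k) (hs3 j k) j) x
    simp only [e2]
    rw [Finset.sum_sub_distrib, bilaplacian_potential]
    refine sub_eq_zero.2 ?_
    have e3 : schwartzDivDiv F = biharmonicConst⁻¹ • schwartzDivDiv fun j k => f ![j, k] := by
      simp only [schwartzDivDiv, hF, schwartzPartial, LineDeriv.lineDerivOp_smul, Finset.smul_sum]
    rw [e3, smul_apply, smul_smul, mul_inv_cancel₀ biharmonicConst_pos.ne', one_smul]
    simp only [schwartzDivDiv, sum_apply, coe_schwartzPartial]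
  · exact tendsto_pi_nhds.2 fun I => (hdec I).tendsto one_le_two
  · exact (decayBdd_potential F hF0).tendsto le_rfl

end Existence
end TensorDecomp

theorem mainTheorem1 {𝕜 : Type*} [RCLike 𝕜]
    (f : (Fin 2 → Fin 2) → SchwartzMap (TensorDecomp.Rn 2) 𝕜)
    (hf : TensorDecomp.IsSymmetric (TensorDecomp.ofSchwartz f)) :
    ((∀ I, ∫ x, f I x = 0) →
      ∃ (g : TensorDecomp.TensorField 𝕜 2 2) (v : TensorDecomp.Rn 2 → 𝕜),
        TensorDecomp.IsDecayingDecomposition (TensorDecomp.ofSchwartz f) g v ∧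
        (∃ C : ℝ, ∀ x, TensorDecomp.tensorNorm (g x) ≤ C * (1 + ‖x‖) ^ (-2 : ℤ)) ∧
        (∀ ℓ : ℕ, ℓ ≤ 1 → ∃ C : ℝ, ∀ x,
          TensorDecomp.tensorNorm (TensorDecomp.innerDPow ℓ v x) ≤
            C * (1 + ‖x‖) ^ (2 - (ℓ : ℤ) - 2)) ∧
        (∀ (g' : TensorDecomp.TensorField 𝕜 2 2) (v' : TensorDecomp.Rn 2 → 𝕜),
          TensorDecomp.IsDecayingDecomposition (TensorDecomp.ofSchwartz f) g' v' →
            g' = g ∧ v' = v)) ∧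
    ((∃ (g : TensorDecomp.TensorField 𝕜 2 2) (v : TensorDecomp.Rn 2 → 𝕜),
        TensorDecomp.IsDecayingDecomposition (TensorDecomp.ofSchwartz f) g v) →
      ∀ I, ∫ x, f I x = 0) := by
  refine ⟨fun h0 => ?_, fun ⟨g, v, h⟩ I => h.integral_eq_zero (fun I => (f I).integrable) hf I⟩
  obtain ⟨g, v, h, hg, hv, hdv⟩ := TensorDecomp.exists_isDecayingDecomposition f hf h0
  refine ⟨g, v, h, TensorDecomp.exists_tensorNorm_le hg, fun ℓ hℓ => ?_,
    fun g' v' h' => h.unique h'⟩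
  have key : ∀ I, TensorDecomp.DecayBdd ℓ (fun x => TensorDecomp.innerDPow ℓ v x I) := by
    interval_cases ℓ
    · exact fun I => hv.mono zero_le_one
    · intro I
      simp_rw [TensorDecomp.innerDPow_one_apply]
      exact hdv (I 0)
  rw [show 2 - (ℓ : ℤ) - 2 = -(ℓ : ℤ) by ring]
  exact TensorDecomp.exists_tensorNorm_le key
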